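/- \textbf{Setting.} Let $N$ be a finite set of agents, partitioned into $A$ and $D=N\setminus A$, let $a=|A|$ (either set may be empty), and let $X\subseteq\mathbb{R}$ be a non-empty set of alternatives. A preference $R_i$ is a complete, transitive and antisymmetric relation on $X$, with strict part $P_i$. It is \emph{single-peaked} if there is $\rho\in X$ such that $x\,P_i\,y$ whenever $\rho\ge x>y$ or $\rho\le x<y$, and \emph{single-dipped} if there is $\delta\in X$ such that $y\,P_i\,x$ whenever $\delta\ge x>y$ or $\delta\le x<y$. Let $\mathcal{R}$ be the set of all profiles $R=(R_i)_{i\in N}$ in which $R_i$ is single-peaked for $i\in A$ and single-dipped for $i\in D$. A \emph{rule} is a function $f:\mathcal{R}\to X$; let $\Omega$ be its range, and assume that $\Omega$ is closed in $\mathbb{R}$. For $R\in\mathcal R$, let $p(R)\in\Omega^A$ be the vector of the most preferred alternatives in $\Omega$ of the agents in $A$. Let $\Omega^2_C=\{(x,y):x,y\in\Omega,\ x<y,\ \Omega\cap\,]x,y[\,=\emptyset\}$ be the set of contiguous pairs. The rule $f$ is \emph{strategy-proof} if $f(R)\,R_i\,f(R'_i,R_{-i})$ for all $R\in\mathcal R$,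 $i\in N$ and admissible $R'_i$. It is \emph{group strategy-proof} if for all $R\in\mathcal R$, all non-empty $S\subseteq N$ and all admissible $R'_S$ there is $i\in S$ with $f(R)\,R_i\,f(R'_S,R_{-S})$. It is \emph{type-anonymous} if $f(R)=f(R_\sigma)$ for all $R\in\mathcal R$ and every permutation $\sigma$ of $N$ with $\sigma(A)=A$, where $(R_\sigma)_i=R_{\sigma(i)}$. \textbf{Two-step rules.} Order $\Omega\cup\Omega^2_C\cup\{-\infty,+\infty\}$ by $\le^*$: on $\Omega$ it is $\le$, each pair $(x,y)\in\Omega^2_C$ lies strictly between $x$ and $y$, and $-\infty$ and $+\infty$ are the least and the greatest element. The \emph{phantoms} $\gamma_1,\dots,\gamma_{a+1}$ are elements of $\Omega\cup\Omega^2_C$; the value $-\infty$ is also allowed if $\Omega$ has no minimum, and $+\infty$ if $\Omega$ has no maximum. It is required that $\gamma_1$ is $\min\Omega$ or the pair of $\Omega^2_C$ containing $\min\Omega$ (and $\gamma_1=-\infty$ if $\Omega$ has no minimum), and that $\gamma_{a+1}$ is $\max\Omega$ or the pair of $\Omega^2_C$ containing $\max\Omega$ (and $\gamma_{a+1}=+\infty$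 if $\Omega$ has no maximum). The associated \emph{mixed median function} $\mathit{med}:\Omega^A\to\Omega\cup\Omega^2_C$ assigns to $\mathbf p$ the median, with respect to $\le^*$, of the $2a+1$ values $(p_i)_{i\in A},\gamma_1,\dots,\gamma_{a+1}$. For a pair $(x,y)\in\Omega^2_C$ in the range of $\mathit{med}$, let $M$ be the number of phantoms equal to $(x,y)$ and $\underline M$ the number of phantoms $\le^*(x,y)$. A \emph{set of minimal double-quotas} for $(x,y)$ is a set $Q$ of at most $M$ elements $q=(q^A,q^D)$ with $q^A\in\{0,1,2,\dots\}$ and $q^D\in\{1,2,\dots\}$ such that no two distinct elements of $Q$ are comparable in the componentwise order and some element of $Q$ has $q^A=(a+1)-\underline M$. A function $t_{(x,y)}:\mathcal R\to\{x,y\}$ is a \emph{double-quota majority method} for $(x,y)$ if there is such a $Q$ for which, at every $R$ with $\mathit{med}(p(R))=(x,y)$, $t_{(x,y)}(R)=x$ if $|\{i\in A:x\,P_i\,y\}|\ge q^A$ and $|\{i\in D:x\,P_i\,y\}|\ge q^D$ for some $(q^A,q^D)\in Q$, and $t_{(x,y)}(R)=y$ otherwise. \textbf{Theorem.} For every rule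 $f$ as above, the following statements are equivalent: (i) $f$ is strategy-proof and type-anonymous; (ii) $f$ is group strategy-proof and type-anonymous; (iii) $f$ is a two-step rule, i.e. there are a mixed median function $\mathit{med}$ and, for each pair $(x,y)\in\Omega^2_C$ in the range of $\mathit{med}$, a double-quota majority method $t_{(x,y)}$ such that for each $R\in\mathcal R$, $f(R)=\mathit{med}(p(R))$ if $\mathit{med}(p(R))\in\Omega$, and $f(R)=t_{\mathit{med}(p(R))}(R)$ if $\mathit{med}(p(R))\in\Omega^2_C$. -/

import Mathlib

namespace TypeAnonymous

/-- A preference over the alternatives in `X`: a complete, transitive and antisymmetric binary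
relation. `R.rel x y` reads "`x` is at least as good as `y`". -/
structure Preference (X : Set ℝ) where
  rel : X → X → Prop
  complete : ∀ x y, rel x y ∨ rel y x
  transitive : ∀ x y z, rel x y → rel y z → rel x z
  antisymmetric : ∀ x y, rel x y → rel y x → x = y

/-- The strict preference induced by `R`. -/
def Preference.strict {X : Set ℝ} (R : Preference X) (x y : X) : Prop :=
  R.rel x y ∧ ¬ R.rel y x

/-- There is a peak `ρ ∈ X` such that moving away from `ρ` on either side makes things worse. -/
def Preference.IsSinglePeaked {X : Set ℝ} (R : Preference X) : Prop :=
  ∃ ρ : X, ∀ x y : X, ((x ≤ ρ ∧ y < x) ∨ (ρ ≤ x ∧ x < y)) → R.strict x y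

/-- There is a dip `δ ∈ X` such that moving away from `δ` on either side makes things better. -/
def Preference.IsSingleDipped {X : Set ℝ} (R : Preference X) : Prop :=
  ∃ δ : X, ∀ x y : X, ((x ≤ δ ∧ y < x) ∨ (δ ≤ x ∧ x < y)) → R.strict y x

/-- A preference profile: the agents in `A` have single-peaked preferences, all the other agents
(the set `D = Aᶜ`) have single-dipped preferences, and every such list is admissible. -/
@[ext]
structure Profile {N : Type*} (A : Set N) (X : Set ℝ) where
  pref : N → Preference X
  peaked : ∀ i ∈ A, (pref i).IsSinglePeaked
  dipped : ∀ i ∈ Aᶜ, (pref i).IsSingleDipped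

section Axioms

variable {N : Type*} {A : Set N} {X : Set ℝ}

/-- No agent gains by misreporting. `R'` is the profile `(R'_i, R_{-i})`. -/
def IsStrategyProof (f : Profile A X → X) : Prop :=
  ∀ (R R' : Profile A X) (i : N), (∀ j, j ≠ i → R'.pref j = R.pref j) →
    (R.pref i).rel (f R) (f R')

/-- No nonempty group of agents can jointly misreport in such a way that all its members gain.
`R'` is the profile `(R'_S, R_{-S})`. -/
def IsGroupStrategyProof (f : Profile A X → X) : Prop :=
  ∀ (R R' : Profile A X) (S : Set N), S.Nonempty → (∀ j, j ∉ S → R'.pref j = R.pref j) →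
    ∃ i ∈ S, (R.pref i).rel (f R) (f R')

/-- The outcome is invariant under permutations of the agents that preserve types.
`R'` is the profile `R_σ`. -/
def IsTypeAnonymous (f : Profile A X → X) : Prop :=
  ∀ (R R' : Profile A X) (σ : Equiv.Perm N), (∀ i, σ i ∈ A ↔ i ∈ A) →
    (∀ i, R'.pref i = R.pref (σ i)) → f R = f R'

end Axioms

/-- `(x, y)` is a pair of contiguous alternatives of `Ω`, i.e. an element of `Ω²_C`. -/
def IsContiguous {X : Set ℝ} (Ω : Set X) (x y : X) : Prop :=
  x ∈ Ω ∧ y ∈ Ω ∧ x < y ∧ Set.Ioo x y ∩ Ω = ∅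

/-- Single alternatives, pairs of alternatives, and the two infinite values. -/
inductive Item (X : Set ℝ) where
  | negInf : Item X
  | single (x : X) : Item X
  | pair (x y : X) : Item X
  | posInf : Item X

/-- Position of an item: a single alternative `x` sits at `(x, x)` and a pair `(x, y)` at `(x, y)`,
in the lexicographic order. -/
noncomputable def Item.key {X : Set ℝ} : Item X → EReal ×ₗ EReal
  | .negInf => toLex (⊥, ⊥)
  | .single x => toLex (((x : ℝ) : EReal), ((x : ℝ) : EReal))
  | .pair x y => toLex (((x : ℝ) : EReal), ((y : ℝ) : EReal))
  | .posInf => toLex (⊤, ⊤)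

/-- The order `≤*`: on single alternatives it is `≤`, a contiguous pair `(x, y)` lies strictly
between `x` and `y`, and the infinite values are at the two ends. -/
noncomputable instance {X : Set ℝ} : LE (Item X) := ⟨fun α β => α.key ≤ β.key⟩

/-- The elements of `Ω ∪ Ω²_C`. -/
def IsFirstStepOutcome {X : Set ℝ} (Ω : Set X) : Item X → Prop
  | .negInf => False
  | .single x => x ∈ Ω
  | .pair x y => IsContiguous Ω x y
  | .posInf => False

/-- The values a phantom may take: the elements of `Ω ∪ Ω²_C`, and in addition `-∞` when `Ω` has
no minimum and `+∞` when `Ω` has no maximum. -/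
def IsPhantom {X : Set ℝ} (Ω : Set X) : Item X → Prop
  | .negInf => ¬ ∃ m, IsLeast Ω m
  | .single x => x ∈ Ω
  | .pair x y => IsContiguous Ω x y
  | .posInf => ¬ ∃ m, IsGreatest Ω m

/-- The item is `min Ω`, or the contiguous pair containing `min Ω`; if `Ω` has no minimum,
the item is `-∞`. -/
def IsLowerEnd {X : Set ℝ} (Ω : Set X) : Item X → Prop
  | .negInf => ¬ ∃ m, IsLeast Ω m
  | .single x => IsLeast Ω x
  | .pair x y => IsLeast Ω x ∧ IsContiguous Ω x y
  | .posInf => False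

/-- The item is `max Ω`, or the contiguous pair containing `max Ω`; if `Ω` has no maximum,
the item is `+∞`. -/
def IsUpperEnd {X : Set ℝ} (Ω : Set X) : Item X → Prop
  | .negInf => False
  | .single x => IsGreatest Ω x
  | .pair x y => IsGreatest Ω y ∧ IsContiguous Ω x y
  | .posInf => ¬ ∃ m, IsGreatest Ω m

/-- `m` is the median of the finite family `b` (used for families of odd size `k`): it is a member
of the family, and at least `(k + 1) / 2` members are `≤* m` and at least `(k + 1) / 2` are
`≥* m`. -/
def IsMedian {X : Set ℝ} {ι : Type*} (b : ι → Item X) (m : Item X) : Prop :=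
  (∃ i, b i = m) ∧ Nat.card ι + 1 ≤ 2 * {i | b i ≤ m}.ncard ∧
    Nat.card ι + 1 ≤ 2 * {i | m ≤ b i}.ncard

section Rules

variable {N : Type*} {A : Set N} {X : Set ℝ}

/-- `p` is the vector `p(R)` of `Ω`-restricted peaks of the agents in `A`: `p i` is the most
preferred alternative of agent `i` in `Ω`. -/
def IsPeakVector (Ω : Set X) (R : Profile A X) (p : A → Ω) : Prop :=
  ∀ i : A, ∀ y ∈ Ω, y ≠ p i → (R.pref i).strict (p i) y

/-- `med` is the mixed median function on `Ω^a` with the `a + 1` phantoms `γ`. -/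
def IsMixedMedian (A : Set N) (Ω : Set X) (γ : Fin (A.ncard + 1) → Item X)
    (med : (A → Ω) → Item X) : Prop :=
  (∀ j, IsPhantom Ω (γ j)) ∧ IsLowerEnd Ω (γ 0) ∧ IsUpperEnd Ω (γ (Fin.last A.ncard)) ∧
    (∀ p, IsFirstStepOutcome Ω (med p)) ∧
    ∀ p : A → Ω, IsMedian (Sum.elim (fun i : A => Item.single (p i : X)) γ) (med p)

/-- `Q` is a set of minimal double-quotas `(q^A, q^D)` for the pair `(x, y)`, given phantoms `γ`.
With `M` the number of phantoms equal to `(x, y)` and `M'` the number of phantoms `≤* (x, y)`: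
`|Q| ≤ M`, every `q^D` is positive, `Q` is an antichain for the componentwise order, and some
element of `Q` has `q^A = (a + 1) - M'`. -/
def IsMinimalDoubleQuotas {a : ℕ} (γ : Fin (a + 1) → Item X) (x y : X)
    (Q : Finset (ℕ × ℕ)) : Prop :=
  Q.card ≤ {j | γ j = Item.pair x y}.ncard ∧
    (∀ q ∈ Q, 1 ≤ q.2) ∧
    IsAntichain (· ≤ ·) (Q : Set (ℕ × ℕ)) ∧
    ∃ q ∈ Q, q.1 + {j | γ j ≤ Item.pair x y}.ncard = a + 1

/-- The number of agents in `S` who strictly prefer `x` to `y` at `R`. -/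
noncomputable def support (S : Set N) (R : Profile A X) (x y : X) : ℕ :=
  {i ∈ S | (R.pref i).strict x y}.ncard

/-- `t` is a double-quota majority method for the pair `(x, y)`: it takes values in `{x, y}` and,
at the profiles whose first-step outcome is `(x, y)`, selects `x` exactly when the supports of `x`
among the agents in `A` and among the agents in `D` reach some double-quota. -/
def IsDoubleQuotaMethod (Ω : Set X) (γ : Fin (A.ncard + 1) → Item X) (med : (A → Ω) → Item X)
    (x y : X) (t : Profile A X → X) : Prop :=
  (∀ R, t R = x ∨ t R = y) ∧
    ∃ Q : Finset (ℕ × ℕ), IsMinimalDoubleQuotas γ x y Q ∧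
      ∀ (R : Profile A X) (p : A → Ω), IsPeakVector Ω R p → med p = Item.pair x y →
        ((∃ q ∈ Q, q.1 ≤ support A R x y ∧ q.2 ≤ support Aᶜ R x y) → t R = x) ∧
        ((¬ ∃ q ∈ Q, q.1 ≤ support A R x y ∧ q.2 ≤ support Aᶜ R x y) → t R = y)

/-- `f`, with range `Ω`, is a two-step rule: a mixed median of the `Ω`-restricted peaks is
computed, and if it is a pair, then a double-quota majority method for that pair decides. -/
def IsTwoStepRule (f : Profile A X → X) : Prop :=
  ∃ (γ : Fin (A.ncard + 1) → Item X) (med : (A → Set.range f) → Item X)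
    (t : X → X → Profile A X → X),
    IsMixedMedian A (Set.range f) γ med ∧
    (∀ x y, (∃ p, med p = Item.pair x y) →
      IsDoubleQuotaMethod (Set.range f) γ med x y (t x y)) ∧
    ∀ (R : Profile A X) (p : A → Set.range f), IsPeakVector (Set.range f) R p →
      (∀ x, med p = Item.single x → f R = x) ∧
      (∀ x y, med p = Item.pair x y → f R = t x y R)

end Rules

end TypeAnonymous

/-! Write Ω for the range of f and D for the complement of A. The question throughout is what
decides, for c in Ω, whether the outcome is at most c. Strategy-proofness is exploited one agent at
a time (`IsStrategyProof.mem_of_step`), with extreme test preferences centred at c that rank one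
whole side of c above the other. An agent whose reported best alternative is c, or whose true worst
alternative is c, cannot move the outcome away from c.

Three facts give the passage from strategy-proofness to two-step rules. An interior point of Ω is
chosen when it is the common peak of A (`IsStrategyProof.eq_of_forall_isBest`). Hence the agents in
D cannot carry the outcome from one side of a point of Ω to the other (`IsStrategyProof.not_lt_lt`),
so they matter only between contiguous alternatives. With type-anonymity and fixed reports in D, the
event that the outcome is at most c depends monotonically on the number of peaks at most c and on
nothing else in A (`IsStrategyProof.le_of_ncard_le`).

So for each k the points c at which k peaks suffice form an upper set of Ω. It is the same for all
reports in D, except possibly at a single point x, which then has a right neighbour y in Ω. The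
threshold of this set, a point, the pair (x, y) or an infinite value, is the phantom with index a -
k (`IsStrategyProof.exists_isForcingItem`), and counting peaks against phantoms turns these
thresholds into the median. At a pair, whether k peaks suffice is monotone in the number of
supporters of x in D (`IsStrategyProof.forces_of_support_le`). The minimal pairs (number of peaks,
number of supporters needed in D) are the double-quotas (`IsStrategyProof.exists_quotas`).

Conversely, if a group gains from a move to the right, its single-peaked members all have peaks to
the right of the outcome, so their misreports cannot raise the median. What remains is a switch from
x to y inside one pair, but the gainers did not support x, so x loses no supporter. Moves to the
left are symmetric. Type-anonymity holds because only counts enter the rule. -/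

namespace TypeAnonymous

/-! ### Extreme test preferences, and best alternatives in a closed range. -/

section Preferences

variable {X : Set ℝ}

/-- The opposite preference. -/
def Preference.reverse (P : Preference X) : Preference X where
  rel x y := P.rel y x
  complete x y := P.complete y x
  transitive x y z h h' := P.transitive z y x h' h
  antisymmetric x y h h' := P.antisymmetric x y h' h

/-- The single-dipped preference with dip `d` that ranks everything to the left of `d` above
everything else. -/
def dipLeft (d : X) : Preference X where
  rel x y := (x < d ∧ (y < d → x ≤ y)) ∨ (d ≤ x ∧ d ≤ y ∧ y ≤ x)
  complete x y := by grind
  transitive x y z := by grind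
  antisymmetric x y := by grind

/-- The single-dipped preference with dip `d` that ranks everything to the right of `d` above
everything else. -/
def dipRight (d : X) : Preference X where
  rel x y := (d < x ∧ (d < y → y ≤ x)) ∨ (x ≤ d ∧ y ≤ d ∧ x ≤ y)
  complete x y := by grind
  transitive x y z := by grind
  antisymmetric x y := by grind

/-- The single-peaked preference with peak `c` that ranks everything up to `c` above
everything else. -/
def peakLeft (c : X) : Preference X := (dipRight c).reverse

/-- The single-peaked preference with peak `c` that ranks everything from `c` on above
everything else. -/
def peakRight (c : X) : Preference X := (dipLeft c).reverse

lemma dipLeft_rel {d x y : X} :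
    (dipLeft d).rel x y ↔ (x < d ∧ (y < d → x ≤ y)) ∨ (d ≤ x ∧ d ≤ y ∧ y ≤ x) := Iff.rfl

lemma dipRight_rel {d x y : X} :
    (dipRight d).rel x y ↔ (d < x ∧ (d < y → y ≤ x)) ∨ (x ≤ d ∧ y ≤ d ∧ x ≤ y) := Iff.rfl

lemma peakLeft_rel {c x y : X} :
    (peakLeft c).rel x y ↔ (c < y ∧ (c < x → x ≤ y)) ∨ (y ≤ c ∧ x ≤ c ∧ y ≤ x) := Iff.rfl

lemma peakRight_rel {c x y : X} :
    (peakRight c).rel x y ↔ (y < c ∧ (x < c → y ≤ x)) ∨ (c ≤ y ∧ c ≤ x ∧ x ≤ y) := Iff.rfl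

lemma isSingleDipped_dipLeft (d : X) : (dipLeft d).IsSingleDipped :=
  ⟨d, fun x y h => by simp only [Preference.strict, dipLeft_rel]; grind⟩

lemma isSingleDipped_dipRight (d : X) : (dipRight d).IsSingleDipped :=
  ⟨d, fun x y h => by simp only [Preference.strict, dipRight_rel]; grind⟩

lemma isSinglePeaked_peakLeft (c : X) : (peakLeft c).IsSinglePeaked :=
  ⟨c, fun x y h => by simp only [Preference.strict, peakLeft_rel]; grind⟩

lemma isSinglePeaked_peakRight (c : X) : (peakRight c).IsSinglePeaked :=
  ⟨c, fun x y h => by simp only [Preference.strict, peakRight_rel]; grind⟩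

/-- `p` is a most preferred element of `Ω`. -/
def Preference.IsBest (P : Preference X) (Ω : Set X) (p : X) : Prop :=
  p ∈ Ω ∧ ∀ y ∈ Ω, P.rel p y

lemma Preference.refl (P : Preference X) (x : X) : P.rel x x := (P.complete x x).elim id id

lemma Preference.strict_of_not_rel {P : Preference X} {x y : X} (h : ¬ P.rel y x) :
    P.strict x y := ⟨(P.complete x y).resolve_right h, h⟩

lemma Preference.IsBest.unique {P : Preference X} {Ω : Set X} {p q : X} (hp : P.IsBest Ω p)
    (hq : P.IsBest Ω q) : p = q :=
  P.antisymmetric _ _ (hp.2 q hq.1) (hq.2 p hp.1)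

lemma isBest_peakLeft {Ω : Set X} {c : X} (hc : c ∈ Ω) : (peakLeft c).IsBest Ω c :=
  ⟨hc, fun y _ => by rw [peakLeft_rel]; grind⟩

lemma isBest_peakRight {Ω : Set X} {c : X} (hc : c ∈ Ω) : (peakRight c).IsBest Ω c :=
  ⟨hc, fun y _ => by rw [peakRight_rel]; grind⟩

/-- The best alternative p in `Ω` may differ from the peak ρ in `X`. Still, no point x of `Ω` lies
strictly after p and before ρ, since x would then beat p. -/
lemma Preference.IsBest.not_rel_of_le_of_lt {P : Preference X} (hP : P.IsSinglePeaked)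
    {Ω : Set X} {p x y : X} (hp : P.IsBest Ω p) (hx : x ∈ Ω) (hy : y ∈ Ω) (hpx : p ≤ x)
    (hxy : x < y) : ¬ P.rel y x := by
  obtain ⟨ρ, hρ⟩ := hP
  rcases hpx.eq_or_lt with rfl | hlt
  · exact fun h => hxy.ne (P.antisymmetric _ _ (hp.2 y hy) h)
  · rcases le_or_gt ρ x with h | h
    · exact (hρ x y (Or.inr ⟨h, hxy⟩)).2
    · exact absurd (hp.2 x hx) (hρ x p (Or.inl ⟨h.le, hlt⟩)).2

lemma Preference.IsBest.not_rel_of_lt_of_le {P : Preference X} (hP : P.IsSinglePeaked)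
    {Ω : Set X} {p x y : X} (hp : P.IsBest Ω p) (hx : x ∈ Ω) (hy : y ∈ Ω) (hyx : y < x)
    (hxp : x ≤ p) : ¬ P.rel y x := by
  obtain ⟨ρ, hρ⟩ := hP
  rcases hxp.eq_or_lt with rfl | hlt
  · exact fun h => hyx.ne' (P.antisymmetric _ _ (hp.2 y hy) h)
  · rcases le_or_gt x ρ with h | h
    · exact (hρ x y (Or.inl ⟨h, hyx⟩)).2
    · exact absurd (hp.2 x hx) (hρ x p (Or.inr ⟨h.le, hlt⟩)).2

/-- If `Ω` is closed in `ℝ`, then a nonempty subset of `Ω` that is bounded below has its infimum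
in `Ω`. -/
lemma exists_isGLB_mem {Ω : Set X} (hΩ : IsClosed (Subtype.val '' Ω)) {T : Set X} (hT : T ⊆ Ω)
    (hne : T.Nonempty) {c : X} (hc : ∀ x ∈ T, c ≤ x) : ∃ m ∈ Ω, IsGLB T m := by
  have hb : BddBelow (Subtype.val '' T) := ⟨c, by rintro _ ⟨x, hx, rfl⟩; exact hc x hx⟩
  have hmem := closure_minimal (Set.image_mono hT) hΩ (csInf_mem_closure (hne.image _) hb)
  obtain ⟨m, hm, hmeq⟩ := hmem
  refine ⟨m, hm, fun x hx => ?_, fun y hy => ?_⟩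
  · rw [← Subtype.coe_le_coe, hmeq]
    exact csInf_le hb (Set.mem_image_of_mem _ hx)
  · rw [← Subtype.coe_le_coe, hmeq]
    refine le_csInf (hne.image _) ?_
    rintro _ ⟨x, hx, rfl⟩
    exact hy hx

lemma exists_isLUB_mem {Ω : Set X} (hΩ : IsClosed (Subtype.val '' Ω)) {T : Set X} (hT : T ⊆ Ω)
    (hne : T.Nonempty) {c : X} (hc : ∀ x ∈ T, x ≤ c) : ∃ m ∈ Ω, IsLUB T m := by
  have hb : BddAbove (Subtype.val '' T) := ⟨c, by rintro _ ⟨x, hx, rfl⟩; exact hc x hx⟩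
  have hmem := closure_minimal (Set.image_mono hT) hΩ (csSup_mem_closure (hne.image _) hb)
  obtain ⟨m, hm, hmeq⟩ := hmem
  refine ⟨m, hm, fun x hx => ?_, fun y hy => ?_⟩
  · rw [← Subtype.coe_le_coe, hmeq]
    exact le_csSup hb (Set.mem_image_of_mem _ hx)
  · rw [← Subtype.coe_le_coe, hmeq]
    refine csSup_le (hne.image _) ?_
    rintro _ ⟨x, hx, rfl⟩
    exact hy hx

/-- The only candidates are the points of `Ω` nearest to ρ on each side; they exist because `Ω` is
closed. -/
lemma Preference.IsSinglePeaked.exists_isBest {P : Preference X} (hP : P.IsSinglePeaked)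
    {Ω : Set X} (hΩ : IsClosed (Subtype.val '' Ω)) (hne : Ω.Nonempty) :
    ∃ p, P.IsBest Ω p := by
  obtain ⟨ρ, hρ⟩ := hP
  have below : ∀ l, IsLUB {x ∈ Ω | x ≤ ρ} l → ∀ y ∈ Ω, y ≤ ρ → P.rel l y := by
    intro l hl y hy hyρ
    rcases (hl.1 ⟨hy, hyρ⟩ : y ≤ l).eq_or_lt with rfl | hlt
    · exact P.refl _
    · exact (hρ l y (Or.inl ⟨hl.2 fun x hx => hx.2, hlt⟩)).1
  have above : ∀ r, IsGLB {x ∈ Ω | ρ ≤ x} r → ∀ y ∈ Ω, ρ ≤ y → P.rel r y := by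
    intro r hr y hy hyρ
    rcases (hr.1 ⟨hy, hyρ⟩ : r ≤ y).eq_or_lt with rfl | hlt
    · exact P.refl _
    · exact (hρ r y (Or.inr ⟨hr.2 fun x hx => hx.2, hlt⟩)).1
  have hl : {x ∈ Ω | x ≤ ρ}.Nonempty → ∃ l ∈ Ω, IsLUB {x ∈ Ω | x ≤ ρ} l := fun h =>
    exists_isLUB_mem hΩ (fun x hx => hx.1) h fun x hx => hx.2
  have hr : {x ∈ Ω | ρ ≤ x}.Nonempty → ∃ r ∈ Ω, IsGLB {x ∈ Ω | ρ ≤ x} r := fun h =>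
    exists_isGLB_mem hΩ (fun x hx => hx.1) h fun x hx => hx.2
  by_cases h1 : {x ∈ Ω | x ≤ ρ}.Nonempty
  · obtain ⟨l, hlΩ, hl⟩ := hl h1
    by_cases h2 : {x ∈ Ω | ρ ≤ x}.Nonempty
    · obtain ⟨r, hrΩ, hr⟩ := hr h2
      rcases P.complete l r with h | h
      · exact ⟨l, hlΩ, fun y hy => (le_total y ρ).elim (below l hl y hy)
          fun hy' => P.transitive _ _ _ h (above r hr y hy hy')⟩
      · exact ⟨r, hrΩ, fun y hy => (le_total ρ y).elim (above r hr y hy)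
          fun hy' => P.transitive _ _ _ h (below l hl y hy hy')⟩
    · exact ⟨l, hlΩ, fun y hy => below l hl y hy
        (le_of_not_ge fun hy' => h2 ⟨y, hy, hy'⟩)⟩
  · obtain ⟨y0, hy0⟩ := hne
    have hge : ∀ y ∈ Ω, ρ ≤ y := fun y hy => le_of_not_ge fun hy' => h1 ⟨y, hy, hy'⟩
    obtain ⟨r, hrΩ, hr⟩ := hr ⟨y0, hy0, hge y0 hy0⟩
    exact ⟨r, hrΩ, fun y hy => above r hr y hy (hge y hy)⟩

end Preferences

/-! ### Profile surgery and sequential changes of reports. -/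

section Profiles

variable {N : Type*} {A : Set N} {X : Set ℝ}

open Classical in
/-- The profile in which the agents in `S` report as in `R'` and the others as in `R`. -/
noncomputable def Profile.mix (S : Set N) (R R' : Profile A X) : Profile A X where
  pref i := if i ∈ S then R'.pref i else R.pref i
  peaked i hi := by split_ifs; exacts [R'.peaked i hi, R.peaked i hi]
  dipped i hi := by split_ifs; exacts [R'.dipped i hi, R.dipped i hi]

lemma Profile.mix_of_mem {S : Set N} (R R' : Profile A X) {i : N} (h : i ∈ S) :
    (Profile.mix S R R').pref i = R'.pref i := by simp [Profile.mix, h]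

lemma Profile.mix_of_notMem {S : Set N} (R R' : Profile A X) {i : N} (h : i ∉ S) :
    (Profile.mix S R R').pref i = R.pref i := by simp [Profile.mix, h]

lemma Profile.mix_eq_right {S : Set N} {R R' : Profile A X}
    (h : ∀ j, j ∉ S → R'.pref j = R.pref j) : Profile.mix S R R' = R' := by
  ext1
  funext i
  by_cases hi : i ∈ S
  · rw [mix_of_mem _ _ hi]
  · rw [mix_of_notMem _ _ hi, h i hi]

open Classical in
/-- All agents are centred at `c` and favour the alternatives to the left. -/
noncomputable def lowProfile (A : Set N) (c : X) : Profile A X where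
  pref i := if i ∈ A then peakLeft c else dipLeft c
  peaked i hi := by rw [if_pos hi]; exact isSinglePeaked_peakLeft c
  dipped i hi := by rw [if_neg hi]; exact isSingleDipped_dipLeft c

open Classical in
/-- All agents are centred at `c` and favour the alternatives to the right. -/
noncomputable def highProfile (A : Set N) (c : X) : Profile A X where
  pref i := if i ∈ A then peakRight c else dipRight c
  peaked i hi := by rw [if_pos hi]; exact isSinglePeaked_peakRight c
  dipped i hi := by rw [if_neg hi]; exact isSingleDipped_dipRight c

lemma lowProfile_of_mem (c : X) {i : N} (h : i ∈ A) :
    (lowProfile A c).pref i = peakLeft c := by simp [lowProfile, h]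

lemma lowProfile_of_notMem (c : X) {i : N} (h : i ∉ A) :
    (lowProfile A c).pref i = dipLeft c := by simp [lowProfile, h]

lemma highProfile_of_mem (c : X) {i : N} (h : i ∈ A) :
    (highProfile A c).pref i = peakRight c := by simp [highProfile, h]

lemma highProfile_of_notMem (c : X) {i : N} (h : i ∉ A) :
    (highProfile A c).pref i = dipRight c := by simp [highProfile, h]

variable {f : Profile A X → X}

/-- When the agents in `S` change their reports one after another, the outcome does not leave a
set `T` that no single change of this kind can leave. -/
lemma IsStrategyProof.mem_of_step [Finite N] (hf : IsStrategyProof f) (S : Set N)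
    {R R' : Profile A X} (hoff : ∀ j, j ∉ S → R'.pref j = R.pref j) (T : Set X)
    (hstep : ∀ i ∈ S, ∀ z ∈ T, ∀ Q : Profile A X, (∀ j, j ∉ S → Q.pref j = R.pref j) →
      (R.pref i).rel z (f Q) → (R'.pref i).rel (f Q) z → f Q ∈ T)
    (h : f R ∈ T) : f R' ∈ T := by
  -- The agents of `U` have already switched. Each further switch yields two incentive constraints,
  -- one for the old and one for the new preference, and `hstep` uses both.
  have key : ∀ U : Set N, U ⊆ S → f (Profile.mix U R R') ∈ T := by
    intro U
    induction U, Set.toFinite U using Set.Finite.induction_on with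
    | empty =>
      intro _
      have : Profile.mix ∅ R R' = R := by
        ext1; funext i; exact Profile.mix_of_notMem _ _ (Set.notMem_empty i)
      rwa [this]
    | @insert i U hiU _ ih =>
      intro hU
      have hoff' : ∀ j, j ≠ i →
          (Profile.mix (insert i U) R R').pref j = (Profile.mix U R R').pref j := by
        intro j hj
        by_cases hjU : j ∈ U
        · rw [Profile.mix_of_mem _ _ hjU, Profile.mix_of_mem _ _ (Set.mem_insert_of_mem i hjU)]
        · rw [Profile.mix_of_notMem _ _ hjU, Profile.mix_of_notMem _ _ (by simp [hj, hjU])]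
      have h1 := hf _ _ i hoff'
      have h2 := hf _ _ i fun j hj => (hoff' j hj).symm
      rw [Profile.mix_of_notMem _ _ hiU] at h1
      rw [Profile.mix_of_mem _ _ (Set.mem_insert i U)] at h2
      refine hstep i (hU (Set.mem_insert i U)) _ (ih ((Set.subset_insert i U).trans hU)) _
        (fun j hj => ?_) h1 h2
      exact Profile.mix_of_notMem _ _ fun hj' => hj (hU hj')
  have := key S subset_rfl
  rwa [Profile.mix_eq_right hoff] at this

end Profiles

/-! ### A common interior peak is chosen. -/

section Unanimity

variable {N : Type*} {A : Set N} {X : Set ℝ}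

/-- The profile in which the agents in `A` report as in `R₁`, the other agents in `S` as in `R₂`,
and the remaining ones as in `R₃`. -/
noncomputable def Profile.mix₃ (S : Set N) (R₁ R₂ R₃ : Profile A X) : Profile A X :=
  Profile.mix A (Profile.mix S R₃ R₂) R₁

lemma Profile.mix₃_of_mem (S : Set N) (R₁ R₂ R₃ : Profile A X) {i : N} (h : i ∈ A) :
    (Profile.mix₃ S R₁ R₂ R₃).pref i = R₁.pref i := by simp [Profile.mix₃, Profile.mix, h]

lemma Profile.mix₃_of_notMem_of_mem {S : Set N} (R₁ R₂ R₃ : Profile A X) {i : N} (h : i ∉ A)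
    (h' : i ∈ S) : (Profile.mix₃ S R₁ R₂ R₃).pref i = R₂.pref i := by
  simp [Profile.mix₃, Profile.mix, h, h']

lemma Profile.mix₃_of_notMem_of_notMem {S : Set N} (R₁ R₂ R₃ : Profile A X) {i : N} (h : i ∉ A)
    (h' : i ∉ S) : (Profile.mix₃ S R₁ R₂ R₃).pref i = R₃.pref i := by
  simp [Profile.mix₃, Profile.mix, h, h']

variable [Finite N] {f : Profile A X → X}

lemma IsStrategyProof.eq_of_isBest (hf : IsStrategyProof f) (S : Set N) {R R' : Profile A X}
    (hoff : ∀ j, j ∉ S → R'.pref j = R.pref j) {c : X}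
    (hbest : ∀ i ∈ S, (R'.pref i).IsBest (Set.range f) c) (h : f R = c) : f R' = c := by
  refine hf.mem_of_step S hoff {c} ?_ h
  rintro i hi z rfl Q _ _ h2
  exact (R'.pref i).antisymmetric _ _ h2 ((hbest i hi).2 _ ⟨Q, rfl⟩)

/-- An agent whose worst alternative is the current outcome would gain from any change of it. This
is how single-dipped agents centred at c are made powerless at c. -/
lemma IsStrategyProof.eq_of_isWorst (hf : IsStrategyProof f) (S : Set N) {R R' : Profile A X}
    (hoff : ∀ j, j ∉ S → R'.pref j = R.pref j) {c : X}
    (hworst : ∀ i ∈ S, ∀ y, (R.pref i).rel y c) (h : f R = c) : f R' = c := by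
  refine hf.mem_of_step S hoff {c} ?_ h
  rintro i hi z rfl Q _ h1 _
  exact (R.pref i).antisymmetric _ _ (hworst i hi _) h1

lemma dipLeft_worst (c y : X) : (dipLeft c).rel y c := by rw [dipLeft_rel]; grind

lemma dipRight_worst (c y : X) : (dipRight c).rel y c := by rw [dipRight_rel]; grind

/-- If `c` is not the outcome at some profile at which it is the common peak of the agents in `A`,
then the outcome is below `c` once all agents are centred at `c` and favour the left. -/
lemma IsStrategyProof.lowProfile_lt (hf : IsStrategyProof f) {b c : X} (hb : b ∈ Set.range f)
    (hbc : b < c) {R : Profile A X}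
    (hR : ∀ i ∈ A, (R.pref i).IsBest (Set.range f) c) (hne : f R ≠ c) :
    f (lowProfile A c) < c := by
  obtain ⟨Rb, hRb⟩ := hb
  have h1 : f (Profile.mix Aᶜ Rb (lowProfile A c)) < c := by
    refine hf.mem_of_step Aᶜ (fun j hj => Profile.mix_of_notMem _ _ hj) {x | x < c} ?_
      (by rw [hRb]; exact hbc)
    intro i hi z hz Q _ _ h2
    rw [Profile.mix_of_mem _ _ hi, lowProfile_of_notMem c hi, dipLeft_rel] at h2
    simp only [Set.mem_ofPred_eq] at hz ⊢
    grind
  have h2 : f (lowProfile A c) ≤ c := by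
    refine hf.mem_of_step A (fun j hj => (Profile.mix_of_mem _ _ hj).symm) {x | x ≤ c} ?_ h1.le
    intro i hi z hz Q _ _ h2
    rw [lowProfile_of_mem c hi, peakLeft_rel] at h2
    simp only [Set.mem_ofPred_eq] at hz ⊢
    grind
  -- At outcome c the agents outside `A`, who all rank c last, can switch to their reports in `R`
  -- without effect, and then so can `A`, whose peak in `R` is c. This would give `f R = c`.
  refine lt_of_le_of_ne h2 fun h3 => hne ?_
  refine hf.eq_of_isBest A (R := Profile.mix A R (lowProfile A c))
    (fun j hj => (Profile.mix_of_notMem _ _ hj).symm) hR ?_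
  refine hf.eq_of_isWorst Aᶜ (fun j hj => Profile.mix_of_mem _ _ (not_not.mp hj)) ?_ h3
  intro i hi y
  rw [lowProfile_of_notMem c hi]
  exact dipLeft_worst c y

lemma IsStrategyProof.lt_highProfile (hf : IsStrategyProof f) {b c : X} (hb : b ∈ Set.range f)
    (hbc : c < b) {R : Profile A X}
    (hR : ∀ i ∈ A, (R.pref i).IsBest (Set.range f) c) (hne : f R ≠ c) :
    c < f (highProfile A c) := by
  obtain ⟨Rb, hRb⟩ := hb
  have h1 : c < f (Profile.mix Aᶜ Rb (highProfile A c)) := by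
    refine hf.mem_of_step Aᶜ (fun j hj => Profile.mix_of_notMem _ _ hj) {x | c < x} ?_
      (by rw [hRb]; exact hbc)
    intro i hi z hz Q _ _ h2
    rw [Profile.mix_of_mem _ _ hi, highProfile_of_notMem c hi, dipRight_rel] at h2
    simp only [Set.mem_ofPred_eq] at hz ⊢
    grind
  have h2 : c ≤ f (highProfile A c) := by
    refine hf.mem_of_step A (fun j hj => (Profile.mix_of_mem _ _ hj).symm) {x | c ≤ x} ?_ h1.le
    intro i hi z hz Q _ _ h2
    rw [highProfile_of_mem c hi, peakRight_rel] at h2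
    simp only [Set.mem_ofPred_eq] at hz ⊢
    grind
  refine lt_of_le_of_ne h2 fun h3 => hne ?_
  refine hf.eq_of_isBest A (R := Profile.mix A R (highProfile A c))
    (fun j hj => (Profile.mix_of_notMem _ _ hj).symm) hR ?_
  refine hf.eq_of_isWorst Aᶜ (fun j hj => Profile.mix_of_mem _ _ (not_not.mp hj)) ?_ h3.symm
  intro i hi y
  rw [highProfile_of_notMem c hi]
  exact dipRight_worst c y

/-- An interior alternative of the range is chosen whenever it is the common peak of the agents
in `A`. -/
theorem IsStrategyProof.eq_of_forall_isBest (hf : IsStrategyProof f) {b c d : X}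
    (hb : b ∈ Set.range f) (hc : c ∈ Set.range f) (hd : d ∈ Set.range f) (hbc : b < c)
    (hcd : c < d) {R : Profile A X} (hR : ∀ i ∈ A, (R.pref i).IsBest (Set.range f) c) :
    f R = c := by
  by_contra hne
  have hlow := hf.lowProfile_lt hb hbc hR hne
  have hhigh := hf.lt_highProfile hd hcd hR hne
  obtain ⟨R0, hR0⟩ := id hc
  set l := lowProfile A c with hl
  set h := highProfile A c with hh
  set l' := lowProfile A d with hl'
  set h' := highProfile A b with hh'
  have dip : ∀ i, i ∉ A → ∃ δ : X, ∀ x y : X, ((x ≤ δ ∧ y < x) ∨ (δ ≤ x ∧ x < y)) →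
      (R0.pref i).strict y x := fun i hi => R0.dipped i hi
  have : Nonempty X := ⟨c⟩
  choose! δ hδ using dip
  -- `R0` produces c. Its single-dipped agents are split by the side of c on which their dip lies.
  -- Those in `S` can be given dip d and the others dip b without disturbing c. Recentring both
  -- groups at c, in the two possible orders, leads to the same profile with contradictory outcomes.
  set S : Set N := {i | i ∉ A ∧ c ≤ δ i} with hS
  have lA : ∀ i ∈ A, l.pref i = peakLeft c := fun i hi => lowProfile_of_mem c hi
  have hA : ∀ i ∈ A, h.pref i = peakRight c := fun i hi => highProfile_of_mem c hi
  have lD : ∀ i, i ∉ A → l.pref i = dipLeft c := fun i hi => lowProfile_of_notMem c hi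
  have hD : ∀ i, i ∉ A → h.pref i = dipRight c := fun i hi => highProfile_of_notMem c hi
  have lD' : ∀ i, i ∉ A → l'.pref i = dipLeft d := fun i hi => lowProfile_of_notMem d hi
  have hD' : ∀ i, i ∉ A → h'.pref i = dipRight b := fun i hi => highProfile_of_notMem b hi
  have pA := fun (R₁ R₂ R₃ : Profile A X) (i : N) (hi : i ∈ A) =>
    Profile.mix₃_of_mem S R₁ R₂ R₃ hi
  have pS := fun (R₁ R₂ R₃ : Profile A X) (i : N) (hi : i ∉ A) (hi' : i ∈ S) =>
    Profile.mix₃_of_notMem_of_mem R₁ R₂ R₃ hi hi'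
  have pT := fun (R₁ R₂ R₃ : Profile A X) (i : N) (hi : i ∉ A) (hi' : i ∉ S) =>
    Profile.mix₃_of_notMem_of_notMem R₁ R₂ R₃ hi hi'
  have hSA : ∀ i ∈ S, i ∉ A := fun i hi => hi.1
  have h0 : f (Profile.mix₃ S l l' h') = c := by
    refine hf.mem_of_step Set.univ (fun j hj => absurd (Set.mem_univ j) hj) {c} ?_ hR0
    rintro i - z rfl Q - h1 h2
    by_cases hiA : i ∈ A
    · rw [pA _ _ _ i hiA, lA i hiA, peakLeft_rel] at h2
      simp only [Set.mem_singleton_iff]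
      grind
    · by_cases hiS : i ∈ S
      · rw [pS _ _ _ i hiA hiS, lD' i hiA, dipLeft_rel] at h2
        have := hδ i hiA z (f Q)
        have hzδ : z ≤ δ i := hiS.2
        simp only [Set.mem_singleton_iff, Preference.strict] at this ⊢
        grind
      · rw [pT _ _ _ i hiA hiS, hD' i hiA, dipRight_rel] at h2
        have := hδ i hiA z (f Q)
        have hzδ : δ i < z := lt_of_not_ge fun hge => hiS ⟨hiA, hge⟩
        simp only [Set.mem_singleton_iff, Preference.strict] at this ⊢
        grind
  -- `S` is recentred first. The outcome cannot fall below c, and it cannot equal c: otherwise `A`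
  -- and `S` could be turned to the right without effect, and the remaining agents could not lift it
  -- above c, against `hhigh`.
  have up : c < f (Profile.mix₃ S l l h) := by
    have h1 : c ≤ f (Profile.mix₃ S l l h') := by
      refine hf.mem_of_step S (fun j hj => ?_) {x | c ≤ x} ?_ h0.ge
      · by_cases hjA : j ∈ A
        · rw [pA _ _ _ j hjA, pA _ _ _ j hjA]
        · rw [pT _ _ _ j hjA hj, pT _ _ _ j hjA hj]
      · intro i hi z hz Q _ h1 _
        rw [pS _ _ _ i (hSA i hi) hi, lD' i (hSA i hi), dipLeft_rel] at h1
        simp only [Set.mem_ofPred_eq] at hz ⊢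
        grind
    have h2 : f (Profile.mix₃ S l l h') ≠ c := by
      intro h2
      have h3 : f (Profile.mix₃ S h l h') = c := by
        refine hf.eq_of_isBest A (fun j hj => ?_) (fun i hi => ?_) h2
        · by_cases hjS : j ∈ S
          · rw [pS _ _ _ j hj hjS, pS _ _ _ j hj hjS]
          · rw [pT _ _ _ j hj hjS, pT _ _ _ j hj hjS]
        · rw [pA _ _ _ i hi, hA i hi]
          exact isBest_peakRight hc
      have h4 : f (Profile.mix₃ S h h h') = c := by
        refine hf.eq_of_isWorst S (fun j hj => ?_) (fun i hi y => ?_) h3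
        · by_cases hjA : j ∈ A
          · rw [pA _ _ _ j hjA, pA _ _ _ j hjA]
          · rw [pT _ _ _ j hjA hj, pT _ _ _ j hjA hj]
        · rw [pS _ _ _ i (hSA i hi) hi, lD i (hSA i hi)]
          exact dipLeft_worst c y
      refine absurd hhigh (not_lt.mpr ?_)
      refine hf.mem_of_step (A ∪ S)ᶜ (fun j hj => ?_) {x | x ≤ c} ?_ h4.le
      · by_cases hjA : j ∈ A
        · rw [pA _ _ _ j hjA]
        · rw [pS _ _ _ j hjA (by simpa [hjA] using hj)]
      · intro i hi z hz Q _ h1 _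
        have hiA : i ∉ A := fun h => hi (Or.inl h)
        rw [pT _ _ _ i hiA (fun h => hi (Or.inr h)), hD' i hiA, dipRight_rel] at h1
        simp only [Set.mem_ofPred_eq] at hz ⊢
        grind
    refine hf.mem_of_step (A ∪ S)ᶜ (fun j hj => ?_) {x | c < x} ?_ (lt_of_le_of_ne h1 h2.symm)
    · by_cases hjA : j ∈ A
      · rw [pA _ _ _ j hjA, pA _ _ _ j hjA]
      · have hjS : j ∈ S := by simpa [hjA] using hj
        rw [pS _ _ _ j hjA hjS, pS _ _ _ j hjA hjS]
    · intro i hi z hz Q _ _ h2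
      have hiA : i ∉ A := fun h => hi (Or.inl h)
      rw [pT _ _ _ i hiA (fun h => hi (Or.inr h)), hD i hiA, dipRight_rel] at h2
      simp only [Set.mem_ofPred_eq] at hz ⊢
      grind
  -- The mirror argument, with the agents outside `A ∪ S` recentred first, contradicting `hlow`.
  have down : f (Profile.mix₃ S l l h) < c := by
    have h1 : f (Profile.mix₃ S l l' h) ≤ c := by
      refine hf.mem_of_step (A ∪ S)ᶜ (fun j hj => ?_) {x | x ≤ c} ?_ h0.le
      · by_cases hjA : j ∈ A
        · rw [pA _ _ _ j hjA, pA _ _ _ j hjA]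
        · have hjS : j ∈ S := by simpa [hjA] using hj
          rw [pS _ _ _ j hjA hjS, pS _ _ _ j hjA hjS]
      · intro i hi z hz Q _ h1 _
        have hiA : i ∉ A := fun h => hi (Or.inl h)
        rw [pT _ _ _ i hiA (fun h => hi (Or.inr h)), hD' i hiA, dipRight_rel] at h1
        simp only [Set.mem_ofPred_eq] at hz ⊢
        grind
    have h2 : f (Profile.mix₃ S l l' h) ≠ c := by
      intro h2
      have h4 : f (Profile.mix₃ S l l' l) = c := by
        refine hf.eq_of_isWorst (A ∪ S)ᶜ (fun j hj => ?_) (fun i hi y => ?_) h2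
        · by_cases hjA : j ∈ A
          · rw [pA _ _ _ j hjA, pA _ _ _ j hjA]
          · have hjS : j ∈ S := by simpa [hjA] using hj
            rw [pS _ _ _ j hjA hjS, pS _ _ _ j hjA hjS]
        · have hiA : i ∉ A := fun h => hi (Or.inl h)
          rw [pT _ _ _ i hiA (fun h => hi (Or.inr h)), hD i hiA]
          exact dipRight_worst c y
      refine absurd hlow (not_lt.mpr ?_)
      refine hf.mem_of_step S (fun j hj => ?_) {x | c ≤ x} ?_ h4.ge
      · by_cases hjA : j ∈ A
        · rw [pA _ _ _ j hjA]
        · rw [pT _ _ _ j hjA hj]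
      · intro i hi z hz Q _ h1 _
        rw [pS _ _ _ i (hSA i hi) hi, lD' i (hSA i hi), dipLeft_rel] at h1
        simp only [Set.mem_ofPred_eq] at hz ⊢
        grind
    refine hf.mem_of_step S (fun j hj => ?_) {x | x < c} ?_ (lt_of_le_of_ne h1 h2)
    · by_cases hjA : j ∈ A
      · rw [pA _ _ _ j hjA, pA _ _ _ j hjA]
      · rw [pT _ _ _ j hjA hj, pT _ _ _ j hjA hj]
    · intro i hi z hz Q _ _ h2
      rw [pS _ _ _ i (hSA i hi) hi, lD i (hSA i hi), dipLeft_rel] at h2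
      simp only [Set.mem_ofPred_eq] at hz ⊢
      grind
  exact lt_asymm up down

end Unanimity

/-! ### What decides on which side of a point of the range the outcome lies. -/

section Cuts

variable {N : Type*} {A : Set N} {X : Set ℝ}

/-- The agents in `A` with a best alternative of `Ω` that is at most `c`. -/
def peaksBelow (Ω : Set X) (R : Profile A X) (c : X) : Set N :=
  {i ∈ A | ∃ p, (R.pref i).IsBest Ω p ∧ p ≤ c}

/-- The agents in `A` with a best alternative of `Ω` that is at least `c`. -/
def peaksAbove (Ω : Set X) (R : Profile A X) (c : X) : Set N :=
  {i ∈ A | ∃ p, (R.pref i).IsBest Ω p ∧ c ≤ p}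

lemma peaksBelow_congr {Ω : Set X} {R R' : Profile A X} (h : ∀ i ∈ A, R'.pref i = R.pref i)
    (c : X) : peaksBelow Ω R' c = peaksBelow Ω R c := by
  ext i
  refine and_congr_right fun hi => ?_
  rw [h i hi]

lemma peaksBelow_mono {Ω : Set X} {R : Profile A X} {b c : X} (h : b ≤ c) :
    peaksBelow Ω R b ⊆ peaksBelow Ω R c :=
  fun _ ⟨hi, p, hp, hpb⟩ => ⟨hi, p, hp, hpb.trans h⟩

lemma peaksBelow_subset {Ω : Set X} {R : Profile A X} {c : X} : peaksBelow Ω R c ⊆ A :=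
  fun _ h => h.1

variable {f : Profile A X → X}

lemma exists_isBest (hΩ : IsClosed (Subtype.val '' Set.range f)) (R : Profile A X) {i : N}
    (hi : i ∈ A) : ∃ p, (R.pref i).IsBest (Set.range f) p :=
  (R.peaked i hi).exists_isBest hΩ ⟨_, R, rfl⟩

lemma mem_peaksAbove_of_notMem (hΩ : IsClosed (Subtype.val '' Set.range f)) {R : Profile A X}
    {i : N} (hi : i ∈ A) {c : X} (h : i ∉ peaksBelow (Set.range f) R c) :
    i ∈ peaksAbove (Set.range f) R c := by
  obtain ⟨p, hp⟩ := exists_isBest hΩ R hi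
  exact ⟨hi, p, hp, le_of_not_ge fun h' => h ⟨hi, p, hp, h'⟩⟩

lemma mem_peaksBelow_of_notMem (hΩ : IsClosed (Subtype.val '' Set.range f)) {R : Profile A X}
    {i : N} (hi : i ∈ A) {c : X} (h : i ∉ peaksAbove (Set.range f) R c) :
    i ∈ peaksBelow (Set.range f) R c := by
  obtain ⟨p, hp⟩ := exists_isBest hΩ R hi
  exact ⟨hi, p, hp, le_of_not_ge fun h' => h ⟨hi, p, hp, h'⟩⟩

/-- The orientation suits permuted profiles: agent i receives the preference of `σ i`, so after
permuting, the agents with a property that held on `S` all lie in `T`. -/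
lemma exists_perm_subset [Finite N] {B S T : Set N} (hS : S ⊆ B) (hT : T ⊆ B)
    (h : S.ncard ≤ T.ncard) :
    ∃ σ : Equiv.Perm N, (∀ i, σ i ∈ B ↔ i ∈ B) ∧ (∀ i, i ∉ B → σ i = i) ∧
      ∀ i, σ i ∈ S → i ∈ T := by
  classical
  obtain ⟨T', hT', hcard⟩ := Set.exists_subset_card_eq h
  have e0 : Nonempty ({x : B // (x : N) ∈ T'} ≃ {x : B // (x : N) ∈ S}) := by
    have h1 : ∀ U : Set N, U ⊆ B → Nonempty ({x : B // (x : N) ∈ U} ≃ U) := fun U hU =>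
      ⟨Equiv.subtypeSubtypeEquivSubtype fun h => hU h⟩
    obtain ⟨e1⟩ := h1 T' (hT'.trans hT)
    obtain ⟨e2⟩ := h1 S hS
    obtain ⟨e3⟩ : Nonempty (T' ≃ S) := by
      have := Fintype.ofFinite T'
      have := Fintype.ofFinite S
      refine ⟨Fintype.equivOfCardEq ?_⟩
      rwa [← Nat.card_eq_fintype_card, ← Nat.card_eq_fintype_card, Nat.card_coe_set_eq,
        Nat.card_coe_set_eq]
    exact ⟨e1.trans (e3.trans e2.symm)⟩
  obtain ⟨e⟩ := e0
  have := Fintype.ofFinite B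
  set τ : Equiv.Perm B := e.extendSubtype with hτ
  refine ⟨Equiv.Perm.ofSubtype τ, fun i => ?_, fun i hi => ?_, fun i hi => ?_⟩
  · by_cases hi : i ∈ B
    · rw [Equiv.Perm.ofSubtype_apply_of_mem τ hi]
      simp [hi]
    · rw [Equiv.Perm.ofSubtype_apply_of_not_mem τ hi]
  · exact Equiv.Perm.ofSubtype_apply_of_not_mem τ hi
  · by_cases hiB : i ∈ B
    · rw [Equiv.Perm.ofSubtype_apply_of_mem τ hiB] at hi
      by_contra hiT
      exact e.extendSubtype_not_mem ⟨i, hiB⟩ (fun h => hiT (hT' h)) hi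
    · rw [Equiv.Perm.ofSubtype_apply_of_not_mem τ hiB] at hi
      exact absurd (hS hi) hiB

/-- The profile in which the agents are permuted by `σ`. -/
def Profile.permute (R : Profile A X) (σ : Equiv.Perm N) (hσ : ∀ i, σ i ∈ A ↔ i ∈ A) :
    Profile A X where
  pref i := R.pref (σ i)
  peaked i hi := R.peaked _ ((hσ i).mpr hi)
  dipped i hi := R.dipped _ fun h => hi ((hσ i).mp h)

variable [Finite N]

/-- The new preference allows only moves to points between z and c, and the old one, with peak at
least c, would strictly gain from any such move. -/
lemma IsStrategyProof.keep_of_lt (hf : IsStrategyProof f) (S : Set N) {R R' : Profile A X}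
    (hoff : ∀ j, j ∉ S → R'.pref j = R.pref j) {c z : X}
    (hS : ∀ i ∈ S, i ∈ peaksAbove (Set.range f) R c) (hR' : ∀ i ∈ S, R'.pref i = peakLeft c)
    (hz : f R = z) (hzc : z < c) : f R' = z := by
  refine hf.mem_of_step S hoff {z} ?_ hz
  rintro i hi w rfl Q - h1 h2
  rw [hR' i hi, peakLeft_rel] at h2
  obtain ⟨hiA, p, hp, hcp⟩ := hS i hi
  have := hp.not_rel_of_lt_of_le (R.peaked i hiA) (x := f Q) (y := w) ⟨Q, rfl⟩ ⟨R, hz⟩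
  simp only [Set.mem_singleton_iff]
  grind

lemma IsStrategyProof.keep_of_gt (hf : IsStrategyProof f) (S : Set N) {R R' : Profile A X}
    (hoff : ∀ j, j ∉ S → R'.pref j = R.pref j) {c z : X}
    (hS : ∀ i ∈ S, i ∈ peaksBelow (Set.range f) R c) (hR' : ∀ i ∈ S, R'.pref i = peakRight c)
    (hz : f R = z) (hcz : c < z) : f R' = z := by
  refine hf.mem_of_step S hoff {z} ?_ hz
  rintro i hi w rfl Q - h1 h2
  rw [hR' i hi, peakRight_rel] at h2
  obtain ⟨hiA, p, hp, hcp⟩ := hS i hi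
  have := hp.not_rel_of_le_of_lt (R.peaked i hiA) (x := f Q) (y := w) ⟨Q, rfl⟩ ⟨R, hz⟩
  simp only [Set.mem_singleton_iff]
  grind

/-- If only agents with a final peak at most `c` change their reports, then an outcome at most `c`
remains so. -/
lemma IsStrategyProof.le_of_le (hf : IsStrategyProof f)
    (hΩ : IsClosed (Subtype.val '' Set.range f)) {c : X} (hc : c ∈ Set.range f)
    {R R' : Profile A X}
    (hoff : ∀ j, j ∉ peaksBelow (Set.range f) R' c → R'.pref j = R.pref j) (h : f R ≤ c) :
    f R' ≤ c := by
  by_contra! hlt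
  set S := peaksBelow (Set.range f) R' c with hS
  set l := lowProfile A c
  set r := highProfile A c
  have hSA : ∀ i ∈ S, i ∈ A := fun i hi => hi.1
  have h1 : f (Profile.mix S R l) ≤ c := by
    refine hf.mem_of_step S (fun j hj => Profile.mix_of_notMem _ _ hj) {x | x ≤ c} ?_ h
    intro i hi z hz Q _ _ h2
    rw [Profile.mix_of_mem _ _ hi, lowProfile_of_mem c (hSA i hi), peakLeft_rel] at h2
    simp only [Set.mem_ofPred_eq] at hz ⊢
    grind
  have h2 : f (Profile.mix S R r) = f R' := by
    refine hf.keep_of_gt S (fun j hj => ?_) (fun i hi => hi) (fun i hi => ?_) rfl hlt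
    · rw [Profile.mix_of_notMem _ _ hj, hoff j hj]
    · rw [Profile.mix_of_mem _ _ hi, highProfile_of_mem c (hSA i hi)]
  -- If the outcome is c, turning `S` from left to right keeps it there, against `h2`. If it is
  -- below c, the agents in `A \ S`, whose peaks are at least c, can also adopt `peakLeft c` without
  -- effect, and unanimity at c is violated.
  rcases h1.eq_or_lt with h3 | h3
  · have : f (Profile.mix S R r) = c := by
      refine hf.eq_of_isBest S (fun j hj => ?_) (fun i hi => ?_) h3
      · rw [Profile.mix_of_notMem _ _ hj, Profile.mix_of_notMem _ _ hj]
      · rw [Profile.mix_of_mem _ _ hi, highProfile_of_mem c (hSA i hi)]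
        exact isBest_peakRight hc
    exact hlt.ne' (h2.symm.trans this)
  · have h4 : f (Profile.mix A (Profile.mix S R l) l) = f (Profile.mix S R l) := by
      refine hf.keep_of_lt (A \ S) (fun j hj => ?_) (fun i hi => ?_) (fun i hi => ?_) rfl h3
      · by_cases hjA : j ∈ A
        · have hjS : j ∈ S := by_contra fun hjS => hj ⟨hjA, hjS⟩
          rw [Profile.mix_of_mem _ _ hjA, Profile.mix_of_mem _ _ hjS]
        · rw [Profile.mix_of_notMem _ _ hjA]
      · obtain ⟨hiA, p, hp, hcp⟩ := mem_peaksAbove_of_notMem hΩ hi.1 hi.2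
        refine ⟨hiA, p, ?_, hcp⟩
        rwa [Profile.mix_of_notMem _ _ hi.2, ← hoff i hi.2]
      · rw [Profile.mix_of_mem _ _ hi.1, lowProfile_of_mem c hi.1]
    refine (h4 ▸ h3).ne (hf.eq_of_forall_isBest (b := f (Profile.mix S R l)) (d := f R')
      ⟨_, rfl⟩ hc ⟨_, rfl⟩ h3 hlt ?_)
    intro i hi
    rw [Profile.mix_of_mem _ _ hi, lowProfile_of_mem c hi]
    exact isBest_peakLeft hc

/-- If only agents with a final peak at least `c` change their reports, then an outcome at least
`c` remains so. -/
lemma IsStrategyProof.ge_of_ge (hf : IsStrategyProof f)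
    (hΩ : IsClosed (Subtype.val '' Set.range f)) {c : X} (hc : c ∈ Set.range f)
    {R R' : Profile A X}
    (hoff : ∀ j, j ∉ peaksAbove (Set.range f) R' c → R'.pref j = R.pref j) (h : c ≤ f R) :
    c ≤ f R' := by
  by_contra! hlt
  set S := peaksAbove (Set.range f) R' c with hS
  set l := lowProfile A c
  set r := highProfile A c
  have hSA : ∀ i ∈ S, i ∈ A := fun i hi => hi.1
  have h1 : c ≤ f (Profile.mix S R r) := by
    refine hf.mem_of_step S (fun j hj => Profile.mix_of_notMem _ _ hj) {x | c ≤ x} ?_ h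
    intro i hi z hz Q _ _ h2
    rw [Profile.mix_of_mem _ _ hi, highProfile_of_mem c (hSA i hi), peakRight_rel] at h2
    simp only [Set.mem_ofPred_eq] at hz ⊢
    grind
  have h2 : f (Profile.mix S R l) = f R' := by
    refine hf.keep_of_lt S (fun j hj => ?_) (fun i hi => hi) (fun i hi => ?_) rfl hlt
    · rw [Profile.mix_of_notMem _ _ hj, hoff j hj]
    · rw [Profile.mix_of_mem _ _ hi, lowProfile_of_mem c (hSA i hi)]
  rcases h1.eq_or_lt with h3 | h3
  · have : f (Profile.mix S R l) = c := by
      refine hf.eq_of_isBest S (fun j hj => ?_) (fun i hi => ?_) h3.symm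
      · rw [Profile.mix_of_notMem _ _ hj, Profile.mix_of_notMem _ _ hj]
      · rw [Profile.mix_of_mem _ _ hi, lowProfile_of_mem c (hSA i hi)]
        exact isBest_peakLeft hc
    exact hlt.ne (h2.symm.trans this)
  · have h4 : f (Profile.mix A (Profile.mix S R r) r) = f (Profile.mix S R r) := by
      refine hf.keep_of_gt (A \ S) (fun j hj => ?_) (fun i hi => ?_) (fun i hi => ?_) rfl h3
      · by_cases hjA : j ∈ A
        · have hjS : j ∈ S := by_contra fun hjS => hj ⟨hjA, hjS⟩
          rw [Profile.mix_of_mem _ _ hjA, Profile.mix_of_mem _ _ hjS]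
        · rw [Profile.mix_of_notMem _ _ hjA]
      · obtain ⟨hiA, p, hp, hcp⟩ := mem_peaksBelow_of_notMem hΩ hi.1 hi.2
        refine ⟨hiA, p, ?_, hcp⟩
        rwa [Profile.mix_of_notMem _ _ hi.2, ← hoff i hi.2]
      · rw [Profile.mix_of_mem _ _ hi.1, highProfile_of_mem c hi.1]
    refine (h4 ▸ h3).ne' (hf.eq_of_forall_isBest (b := f R') (d := f (Profile.mix S R r))
      ⟨_, rfl⟩ hc ⟨_, rfl⟩ hlt h3 ?_)
    intro i hi
    rw [Profile.mix_of_mem _ _ hi, highProfile_of_mem c hi]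
    exact isBest_peakRight hc

/-- If the agents that change their reports have peaks above `c` before and after the change, then
an outcome at most `c` remains so. -/
lemma IsStrategyProof.le_of_forall_lt (hf : IsStrategyProof f)
    (hΩ : IsClosed (Subtype.val '' Set.range f)) {c : X} {R R' : Profile A X} (S : Set N)
    (hSA : S ⊆ A) (hoff : ∀ j, j ∉ S → R'.pref j = R.pref j)
    (hS : ∀ i ∈ S, i ∉ peaksBelow (Set.range f) R c) (h : f R ≤ c) : f R' ≤ c := by
  by_contra! hlt
  -- The range may accumulate at c from the right, so a cut t strictly above c is taken as the
  -- minimum of `f R'` and the finitely many peaks in `R`. Going back from `R'` to `R` then cannot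
  -- bring the outcome below t.
  have key : ∀ U : Set N, U ⊆ S → ∃ t ∈ Set.range f, c < t ∧ t ≤ f R' ∧
      ∀ i ∈ U, i ∈ peaksAbove (Set.range f) R t := by
    intro U
    induction U, Set.toFinite U using Set.Finite.induction_on with
    | empty => exact fun _ => ⟨f R', ⟨R', rfl⟩, hlt, le_rfl, by simp⟩
    | @insert i U _ _ ih =>
      intro hU
      obtain ⟨t, ht, hct, htR, htU⟩ := ih ((Set.subset_insert i U).trans hU)
      have hiS := hU (Set.mem_insert i U)
      obtain ⟨p, hp⟩ := exists_isBest hΩ R (hSA hiS)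
      have hcp : c < p := lt_of_not_ge fun hpc => hS i hiS ⟨hSA hiS, p, hp, hpc⟩
      refine ⟨min t p, ?_, lt_min hct hcp, (min_le_left _ _).trans htR, ?_⟩
      · rcases min_choice t p with h | h <;> rw [h]
        exacts [ht, hp.1]
      · rintro j (rfl | hj)
        · exact ⟨hSA hiS, p, hp, min_le_right _ _⟩
        · obtain ⟨hjA, q, hq, hqt⟩ := htU j hj
          exact ⟨hjA, q, hq, (min_le_left _ _).trans hqt⟩
  obtain ⟨t, ht, hct, htR, htS⟩ := key S subset_rfl
  exact absurd (hf.ge_of_ge hΩ ht (R := R') (R' := R)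
    (fun j hj => (hoff j fun hjS => hj (htS j hjS)).symm) htR)
    (not_le.mpr (h.trans_lt hct))

/-- Whether the outcome is at most `c` depends on the reports in `A` only through the number of
peaks that are at most `c`, and monotonically so. -/
theorem IsStrategyProof.le_of_ncard_le (hf : IsStrategyProof f) (ha : IsTypeAnonymous f)
    (hΩ : IsClosed (Subtype.val '' Set.range f)) {c : X} (hc : c ∈ Set.range f)
    {R R' : Profile A X} (hD : ∀ j, j ∉ A → R'.pref j = R.pref j)
    (hcard : (peaksBelow (Set.range f) R c).ncard ≤ (peaksBelow (Set.range f) R' c).ncard)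
    (h : f R ≤ c) : f R' ≤ c := by
  -- After permuting `A`, the agents with peak at most c are among those having such a peak in `R'`.
  -- The latter switch to `R'` first; everyone left then starts from a peak above c.
  obtain ⟨σ, hσ, hσD, hσS⟩ := exists_perm_subset (B := A) (fun i hi => hi.1) (fun i hi => hi.1)
    hcard
  set S := peaksBelow (Set.range f) R' c with hS
  set R1 := R.permute σ hσ
  have hR1 : f R1 ≤ c := by rwa [← ha R R1 σ hσ fun i => rfl]
  have hR1D : ∀ j, j ∉ A → R1.pref j = R.pref j := fun j hj => by
    change R.pref (σ j) = _
    rw [hσD j hj]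
  have hsub : S ⊆ peaksBelow (Set.range f) (Profile.mix S R1 R') c := by
    intro i hi
    obtain ⟨hiA, p, hp, hpc⟩ := id hi
    exact ⟨hiA, p, by rwa [Profile.mix_of_mem _ _ hi], hpc⟩
  have h2 : f (Profile.mix S R1 R') ≤ c :=
    hf.le_of_le hΩ hc (fun j hj => Profile.mix_of_notMem _ _ fun h => hj (hsub h)) hR1
  refine hf.le_of_forall_lt hΩ (A \ S) Set.sdiff_subset (fun j hj => ?_) (fun i hi hi' => ?_) h2
  · by_cases hjA : j ∈ A
    · have hjS : j ∈ S := by_contra fun hjS => hj ⟨hjA, hjS⟩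
      rw [Profile.mix_of_mem _ _ hjS]
    · rw [Profile.mix_of_notMem _ _ fun h => hjA h.1, hR1D j hjA, hD j hjA]
  · obtain ⟨hiA, p, hp, hpc⟩ := hi'
    rw [Profile.mix_of_notMem _ _ hi.2] at hp
    exact hi.2 (hσS i ⟨(hσ i).mpr hiA, p, hp, hpc⟩)

/-- The agents outside `A` cannot move the outcome across an alternative of the range. -/
theorem IsStrategyProof.not_lt_lt (hf : IsStrategyProof f)
    (hΩ : IsClosed (Subtype.val '' Set.range f)) {c : X} (hc : c ∈ Set.range f)
    {R R' : Profile A X} (hA : ∀ i ∈ A, R'.pref i = R.pref i) (h : f R < c) : ¬ c < f R' := by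
  intro h'
  set l := lowProfile A c
  set r := highProfile A c
  set B := peaksBelow (Set.range f) R c with hB
  have hBA : ∀ i ∈ B, i ∈ A := fun i hi => hi.1
  have q1 : f (Profile.mix Aᶜ R l) < c := by
    refine hf.mem_of_step Aᶜ (fun j hj => Profile.mix_of_notMem _ _ hj) {x | x < c} ?_ h
    intro i hi z hz Q _ _ h2
    rw [Profile.mix_of_mem _ _ hi, lowProfile_of_notMem c hi, dipLeft_rel] at h2
    simp only [Set.mem_ofPred_eq] at hz ⊢
    grind
  have q2 : c < f (Profile.mix Aᶜ R r) := by
    refine hf.mem_of_step Aᶜ (R := R') (fun j hj => ?_) {x | c < x} ?_ h'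
    · rw [Profile.mix_of_notMem _ _ hj, hA j (not_not.mp hj)]
    · intro i hi z hz Q _ _ h2
      rw [Profile.mix_of_mem _ _ hi, highProfile_of_notMem c hi, dipRight_rel] at h2
      simp only [Set.mem_ofPred_eq] at hz ⊢
      grind
  have hB1 : ∀ Q : Profile A X, peaksBelow (Set.range f) (Profile.mix Aᶜ R Q) c = B := fun Q =>
    peaksBelow_congr (fun i hi => Profile.mix_of_notMem _ _ (not_not.mpr hi)) c
  have hB2 : ∀ Q : Profile A X, B ⊆ peaksBelow (Set.range f) (Profile.mix B Q l) c := by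
    intro Q i hi
    refine ⟨hBA i hi, c, ?_, le_rfl⟩
    rw [Profile.mix_of_mem _ _ hi, lowProfile_of_mem c (hBA i hi)]
    exact isBest_peakLeft hc
  -- Otherwise `B` could return to its peaks, all at most c, and the outcome would stay at most c,
  -- against `q2`.
  have q3 : c < f (Profile.mix B (Profile.mix Aᶜ R r) l) := by
    by_contra! hle
    refine absurd q2 (not_lt.mpr (hf.le_of_le hΩ hc (fun j hj => ?_) hle))
    rw [hB1] at hj
    rw [Profile.mix_of_notMem _ _ hj]
  have q4 : f (Profile.mix B (Profile.mix Aᶜ R l) l) ≤ c :=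
    hf.le_of_le hΩ hc (fun j hj => Profile.mix_of_notMem _ _ fun hjB => hj (hB2 _ hjB)) q1.le
  -- At c the agents outside `A` would be at their worst point, hence unable to produce `q3`. So the
  -- outcome is strictly below c, and moving the rest of `A` to peak c violates unanimity.
  have q4' : f (Profile.mix B (Profile.mix Aᶜ R l) l) ≠ c := by
    intro heq
    refine q3.ne' (hf.eq_of_isWorst Aᶜ (fun j hj => ?_) (fun i hi y => ?_) heq)
    · by_cases hjB : j ∈ B
      · rw [Profile.mix_of_mem _ _ hjB, Profile.mix_of_mem _ _ hjB]
      · rw [Profile.mix_of_notMem _ _ hjB, Profile.mix_of_notMem _ _ hjB,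
          Profile.mix_of_notMem _ _ hj, Profile.mix_of_notMem _ _ hj]
    · rw [Profile.mix_of_notMem _ _ fun hiB => hi (hBA i hiB), Profile.mix_of_mem _ _ hi,
        lowProfile_of_notMem c hi]
      exact dipLeft_worst c y
  have q4lt := lt_of_le_of_ne q4 q4'
  set Q4 := Profile.mix B (Profile.mix Aᶜ R l) l with hQ4
  have q5 : f (Profile.mix A Q4 l) = f Q4 := by
    refine hf.keep_of_lt (A \ B) (fun j hj => ?_) (fun i hi => ?_) (fun i hi => ?_) rfl q4lt
    · by_cases hjA : j ∈ A
      · have hjB : j ∈ B := by_contra fun hjB => hj ⟨hjA, hjB⟩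
        rw [Profile.mix_of_mem _ _ hjA, Profile.mix_of_mem _ _ hjB]
      · rw [Profile.mix_of_notMem _ _ hjA]
    · obtain ⟨hiA, p, hp, hcp⟩ := mem_peaksAbove_of_notMem hΩ hi.1 hi.2
      refine ⟨hiA, p, ?_, hcp⟩
      rwa [Profile.mix_of_notMem _ _ hi.2, Profile.mix_of_notMem _ _ (not_not.mpr hiA)]
    · rw [Profile.mix_of_mem _ _ hi.1, lowProfile_of_mem c hi.1]
  refine (q5 ▸ q4lt).ne (hf.eq_of_forall_isBest ⟨_, rfl⟩ hc ⟨_, rfl⟩ h h' fun i hi => ?_)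
  rw [Profile.mix_of_mem _ _ hi, lowProfile_of_mem c hi]
  exact isBest_peakLeft hc

end Cuts

/-! ### The order on points, pairs and infinite values. -/

section Items

variable {X : Set ℝ}

lemma Item.le_iff {α β : Item X} : α ≤ β ↔ α.key ≤ β.key := Iff.rfl

lemma Item.single_le_single {x y : X} : Item.single x ≤ Item.single y ↔ x ≤ y := by
  rw [Item.le_iff, Item.key, Item.key, Prod.Lex.toLex_le_toLex]
  simp only [EReal.coe_lt_coe_iff, EReal.coe_eq_coe_iff, EReal.coe_le_coe_iff,
    Subtype.coe_lt_coe, Subtype.coe_le_coe, Subtype.coe_inj]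
  grind

lemma Item.single_le_pair {c x y : X} (h : x < y) : Item.single c ≤ Item.pair x y ↔ c ≤ x := by
  rw [Item.le_iff, Item.key, Item.key, Prod.Lex.toLex_le_toLex]
  simp only [EReal.coe_lt_coe_iff, EReal.coe_eq_coe_iff, EReal.coe_le_coe_iff,
    Subtype.coe_lt_coe, Subtype.coe_le_coe, Subtype.coe_inj]
  grind

lemma Item.pair_le_single {c x y : X} (h : x < y) : Item.pair x y ≤ Item.single c ↔ x < c := by
  rw [Item.le_iff, Item.key, Item.key, Prod.Lex.toLex_le_toLex]
  simp only [EReal.coe_lt_coe_iff, EReal.coe_eq_coe_iff, EReal.coe_le_coe_iff,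
    Subtype.coe_lt_coe, Subtype.coe_le_coe, Subtype.coe_inj]
  grind

lemma Item.pair_le_pair {x y x' y' : X} :
    Item.pair x y ≤ Item.pair x' y' ↔ x < x' ∨ x = x' ∧ y ≤ y' := by
  rw [Item.le_iff, Item.key, Item.key, Prod.Lex.toLex_le_toLex]
  simp only [EReal.coe_lt_coe_iff, EReal.coe_eq_coe_iff, EReal.coe_le_coe_iff,
    Subtype.coe_lt_coe, Subtype.coe_le_coe, Subtype.coe_inj]

lemma Item.negInf_le (α : Item X) : Item.negInf ≤ α := by
  rw [Item.le_iff, Item.key]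
  cases α <;> simp [Item.key, Prod.Lex.toLex_le_toLex]

lemma Item.le_posInf (α : Item X) : α ≤ Item.posInf := by
  rw [Item.le_iff]
  cases α <;> simp [Item.key, Prod.Lex.toLex_le_toLex]

lemma Item.not_single_le_negInf (x : X) : ¬ Item.single x ≤ Item.negInf := by
  rw [Item.le_iff]
  simp [Item.key, Prod.Lex.toLex_le_toLex]

lemma Item.not_pair_le_negInf (x y : X) : ¬ Item.pair x y ≤ Item.negInf := by
  rw [Item.le_iff]
  simp [Item.key, Prod.Lex.toLex_le_toLex]

lemma Item.not_posInf_le_negInf : ¬ (Item.posInf : Item X) ≤ Item.negInf := by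
  rw [Item.le_iff]
  simp [Item.key, Prod.Lex.toLex_le_toLex]

lemma Item.not_posInf_le_single (x : X) : ¬ Item.posInf ≤ Item.single x := by
  rw [Item.le_iff]
  simp [Item.key, Prod.Lex.toLex_le_toLex]

lemma Item.not_posInf_le_pair (x y : X) : ¬ Item.posInf ≤ Item.pair x y := by
  rw [Item.le_iff]
  simp [Item.key, Prod.Lex.toLex_le_toLex]

lemma Item.le_trans' {α β γ : Item X} (h : α ≤ β) (h' : β ≤ γ) : α ≤ γ :=
  le_trans (α := EReal ×ₗ EReal) h h'

/-- An item that is equivalent to a proper pair is equal to it. -/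
lemma Item.eq_of_le_of_le {α : Item X} {x y : X} (hxy : x < y)
    (hα : ∀ x' y', α = Item.pair x' y' → x' < y')
    (h : α ≤ Item.pair x y) (h' : Item.pair x y ≤ α) : α = Item.pair x y := by
  cases α with
  | negInf => exact absurd h' (not_pair_le_negInf x y)
  | single c => exact absurd ((single_le_pair hxy).mp h) (not_le.mpr ((pair_le_single hxy).mp h'))
  | pair a b =>
    rw [pair_le_pair] at h h'
    have := hα a b rfl
    grind
  | posInf => exact absurd h (not_posInf_le_pair x y)

end Items

/-! ### Forcing thresholds and the phantoms they define. -/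

section Forcing

variable {N : Type*} {A : Set N} {X : Set ℝ}

/-- Given the reports of the agents outside `A`, it is enough that `k` agents in `A` have their
peaks at most at `c` for the outcome to be at most `c`. -/
def Forces (f : Profile A X → X) (c : X) (k : ℕ) (R : Profile A X) : Prop :=
  ∀ Q : Profile A X, (∀ j, j ∉ A → Q.pref j = R.pref j) →
    k ≤ (peaksBelow (Set.range f) Q c).ncard → f Q ≤ c

variable {f : Profile A X → X}

lemma Forces.mono {c : X} {k k' : ℕ} {R : Profile A X} (h : Forces f c k R) (hk : k ≤ k') :
    Forces f c k' R :=
  fun Q hQ hc => h Q hQ (hk.trans hc)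

/-- There is a profile with `k` peaks at `b`, the others at `e`, and prescribed reports outside
`A`. -/
lemma exists_split_profile {b e : X} (hb : b ∈ Set.range f) (he : e ∈ Set.range f) {k : ℕ}
    (hk : k ≤ A.ncard) :
    ∃ P : Profile A X → Profile A X, (∀ R, ∀ j, j ∉ A → (P R).pref j = R.pref j) ∧
      (∀ R R', ∀ i ∈ A, (P R).pref i = (P R').pref i) ∧
      ∀ R c, b ≤ c → c < e → (peaksBelow (Set.range f) (P R) c).ncard = k := by
  obtain ⟨B, hBA, hB⟩ := Set.exists_subset_card_eq hk
  refine ⟨fun R => Profile.mix A R (Profile.mix B (lowProfile A e) (lowProfile A b)),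
    fun R j hj => Profile.mix_of_notMem _ _ hj, fun R R' i hi => ?_, fun R c hbc hce => ?_⟩
  · rw [Profile.mix_of_mem _ _ hi, Profile.mix_of_mem _ _ hi]
  · rw [← hB]
    congr 1
    ext i
    constructor
    · rintro ⟨hi, p, hp, hpc⟩
      by_contra hiB
      rw [Profile.mix_of_mem _ _ hi, Profile.mix_of_notMem _ _ hiB, lowProfile_of_mem e hi] at hp
      rw [hp.unique (isBest_peakLeft he)] at hpc
      exact absurd hpc (not_le.mpr hce)
    · intro hiB
      have hi := hBA hiB
      refine ⟨hi, b, ?_, hbc⟩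
      rw [Profile.mix_of_mem _ _ hi, Profile.mix_of_mem _ _ hiB, lowProfile_of_mem b hi]
      exact isBest_peakLeft hb

lemma IsContiguous.le_of_lt {Ω : Set X} {x y c : X} (h : IsContiguous Ω x y) (hc : c ∈ Ω)
    (hxc : x < c) : y ≤ c := by
  by_contra! hlt
  have : c ∈ Set.Ioo x y ∩ Ω := ⟨⟨hxc, hlt⟩, hc⟩
  rw [h.2.2.2] at this
  exact this

lemma IsContiguous.lt {Ω : Set X} {x y : X} (h : IsContiguous Ω x y) : x < y := h.2.2.1

/-- The position of the item `γ` relative to the items of the first step tells which alternatives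
can be forced by `k` agents in `A`. -/
structure IsForcingItem (f : Profile A X → X) (k : ℕ) (γ : Item X) : Prop where
  isPhantom : IsPhantom (Set.range f) γ
  le_single_iff : ∀ c ∈ Set.range f, γ ≤ Item.single c ↔ ∀ R, Forces f c k R
  single_le_iff : ∀ c ∈ Set.range f,
    Item.single c ≤ γ ↔ ∀ b ∈ Set.range f, b < c → ∀ R, ¬ Forces f b k R
  le_pair_iff : ∀ x y, IsContiguous (Set.range f) x y →
    (γ ≤ Item.pair x y ↔ ∃ R, Forces f x k R)
  pair_le_iff : ∀ x y, IsContiguous (Set.range f) x y →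
    (Item.pair x y ≤ γ ↔ ∃ R, ¬ Forces f x k R)

lemma IsForcingItem.isUpperEnd {γ : Item X} (h : IsForcingItem f 0 γ)
    (hne : (Set.range f).Nonempty) : IsUpperEnd (Set.range f) γ := by
  have hgreatest : ∀ c ∈ Set.range f, γ ≤ Item.single c → IsGreatest (Set.range f) c := by
    refine fun c hc hcγ => ⟨hc, ?_⟩
    rintro _ ⟨R, rfl⟩
    exact (h.le_single_iff c hc).mp hcγ R R (fun _ _ => rfl) (Nat.zero_le _)
  have hph := h.isPhantom
  cases γ with
  | negInf =>
    obtain ⟨c, hc⟩ := hne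
    refine hph ⟨c, hc, fun d hd => ?_⟩
    exact (hgreatest d hd (Item.negInf_le _)).2 hc
  | single c => exact hgreatest c hph (Item.single_le_single.mpr le_rfl)
  | pair x y =>
    exact ⟨hgreatest y hph.2.1 ((Item.pair_le_single hph.lt).mpr hph.lt), hph⟩
  | posInf => exact hph

variable [Finite N]

/-- By the counting theorem, a single profile with few peaks below c and outcome at most c already
certifies forcing. -/
lemma IsStrategyProof.forces_of_le (hf : IsStrategyProof f) (ha : IsTypeAnonymous f)
    (hΩ : IsClosed (Subtype.val '' Set.range f)) {c : X} (hc : c ∈ Set.range f)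
    {R Q : Profile A X} (hQ : ∀ j, j ∉ A → Q.pref j = R.pref j) {k : ℕ}
    (hk : (peaksBelow (Set.range f) Q c).ncard ≤ k) (h : f Q ≤ c) : Forces f c k R :=
  fun Q' hQ' hk' => hf.le_of_ncard_le ha hΩ hc (fun j hj => by rw [hQ' j hj, hQ j hj])
    (hk.trans hk') h

/-- The agents outside `A` can only have influence between two contiguous alternatives. -/
lemma IsStrategyProof.eq_of_forces (hf : IsStrategyProof f) (ha : IsTypeAnonymous f)
    (hΩ : IsClosed (Subtype.val '' Set.range f)) {b c : X} (hb : b ∈ Set.range f)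
    (hc : c ∈ Set.range f) (hbc : b ≤ c) {k : ℕ} (hk : k ≤ A.ncard) {R R' : Profile A X}
    (h : Forces f b k R) (h' : ¬ Forces f c k R') :
    b = c ∧ ∃ y, IsContiguous (Set.range f) c y := by
  obtain ⟨Q, hQ, hkQ, hcQ⟩ : ∃ Q : Profile A X, (∀ j, j ∉ A → Q.pref j = R'.pref j) ∧
      k ≤ (peaksBelow (Set.range f) Q c).ncard ∧ c < f Q := by
    unfold Forces at h'
    push Not at h'
    exact h'
  -- With k peaks at b and the others at `f Q`, changing only the reports outside `A` moves the
  -- outcome from at most b to above c. As it cannot cross a point of the range, nothing fits in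
  -- between.
  obtain ⟨P, hPD, hPA, hPk⟩ := exists_split_profile (f := f) (A := A) hb ⟨Q, rfl⟩ hk
  have h1 : f (P R) ≤ b := h _ (hPD R) (hPk R b le_rfl (hbc.trans_lt hcQ)).ge
  have h2 : c < f (P R') := by
    by_contra! hle
    exact h' (hf.forces_of_le ha hΩ hc (hPD R') (hPk R' c hbc hcQ).le hle)
  have hcut : ∀ e ∈ Set.range f, f (P R) < e → ¬ e < f (P R') := fun e he =>
    hf.not_lt_lt hΩ he (hPA R' R)
  have hbc' : b = c := hbc.antisymm (le_of_not_gt fun hlt => hcut c hc (h1.trans_lt hlt) h2)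
  refine ⟨hbc', f (P R'), hc, ⟨_, rfl⟩, h2, ?_⟩
  ext e
  simp only [Set.mem_inter_iff, Set.mem_Ioo, Set.mem_empty_iff_false, iff_false]
  rintro ⟨⟨hce, heR⟩, he⟩
  exact hcut e he (h1.trans_lt (hbc'.trans_lt hce)) heR

theorem IsStrategyProof.exists_isForcingItem (hf : IsStrategyProof f) (ha : IsTypeAnonymous f)
    (hΩ : IsClosed (Subtype.val '' Set.range f)) (hne : (Set.range f).Nonempty) {k : ℕ}
    (hk : k ≤ A.ncard) : ∃ γ, IsForcingItem f k γ := by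
  obtain ⟨_, R0, -⟩ := id hne
  have G : ∀ b ∈ Set.range f, ∀ c ∈ Set.range f, b ≤ c → ∀ R R', Forces f b k R →
      ¬ Forces f c k R' → b = c ∧ ∃ y, IsContiguous (Set.range f) c y :=
    fun b hb c hc hbc R R' h h' => hf.eq_of_forces ha hΩ hb hc hbc hk h h'
  -- If forcing at some x depends on the reports outside `A`, the item is the pair starting at x.
  -- Otherwise the forced points form one upper set `V`, and the item is its minimum, or an infinite
  -- value if it has none.
  by_cases hpair : ∃ x ∈ Set.range f, (∃ R, Forces f x k R) ∧ ∃ R, ¬ Forces f x k R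
  · obtain ⟨x, hx, ⟨R, hR⟩, R', hR'⟩ := hpair
    obtain ⟨-, y, hy⟩ := G x hx x hx le_rfl R R' hR hR'
    have hall : ∀ c ∈ Set.range f, x < c → ∀ Q, Forces f c k Q := by
      intro c hc hxc Q
      by_contra hQ
      exact hxc.ne (G x hx c hc hxc.le R Q hR hQ).1
    have hnone : ∀ b ∈ Set.range f, b < x → ∀ Q, ¬ Forces f b k Q := by
      intro b hb hbx Q hQ
      exact hbx.ne (G b hb x hx hbx.le Q R' hQ hR').1
    refine ⟨Item.pair x y, hy, fun c hc => ?_, fun c hc => ?_, fun x' y' h' => ?_,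
      fun x' y' h' => ?_⟩
    · rw [Item.pair_le_single hy.lt]
      refine ⟨hall c hc, fun h => lt_of_not_ge fun hle => ?_⟩
      rcases hle.eq_or_lt with rfl | hlt
      exacts [hR' (h R'), hnone c hc hlt R (h R)]
    · rw [Item.single_le_pair hy.lt]
      refine ⟨fun h b hb hbc => hnone b hb (hbc.trans_le h), fun h => le_of_not_gt fun hlt => ?_⟩
      exact h x hx hlt R hR
    · rw [Item.pair_le_pair]
      constructor
      · rintro (h | ⟨rfl, -⟩)
        exacts [⟨R, hall x' h'.1 h R⟩, ⟨R, hR⟩]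
      · rintro ⟨Q, hQ⟩
        rcases lt_trichotomy x x' with h | h | h
        · exact Or.inl h
        · exact Or.inr ⟨h, hy.le_of_lt h'.2.1 (h ▸ h'.lt)⟩
        · exact absurd hQ (hnone x' h'.1 h Q)
    · rw [Item.pair_le_pair]
      constructor
      · rintro (h | ⟨rfl, -⟩)
        exacts [⟨R, hnone x' h'.1 h R⟩, ⟨R', hR'⟩]
      · rintro ⟨Q, hQ⟩
        rcases lt_trichotomy x x' with h | h | h
        · exact absurd (hall x' h'.1 h Q) hQ
        · exact Or.inr ⟨h.symm, h'.le_of_lt hy.2.1 (h ▸ hy.lt)⟩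
        · exact Or.inl h
  · have hconst : ∀ c ∈ Set.range f, ∀ R R', Forces f c k R → Forces f c k R' := by
      intro c hc R R' h
      by_contra h'
      exact hpair ⟨c, hc, ⟨R, h⟩, R', h'⟩
    have hup : ∀ b ∈ Set.range f, ∀ c ∈ Set.range f, b ≤ c → ∀ R R', Forces f b k R →
        Forces f c k R' := by
      intro b hb c hc hbc R R' h
      by_contra h'
      obtain ⟨rfl, -⟩ := G b hb c hc hbc R R' h h'
      exact h' (hconst b hb R R' h)
    set V : Set X := {c ∈ Set.range f | Forces f c k R0} with hV
    by_cases hmin : ∃ m, IsLeast V m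
    · obtain ⟨m, ⟨hm, hmF⟩, hmin⟩ := hmin
      have hiff : ∀ c ∈ Set.range f, ∀ R, Forces f c k R ↔ m ≤ c := fun c hc R =>
        ⟨fun h => hmin ⟨hc, hconst c hc R R0 h⟩, fun h => hup m hm c hc h R0 R hmF⟩
      refine ⟨Item.single m, hm, fun c hc => ?_, fun c hc => ?_, fun x' y' h' => ?_,
        fun x' y' h' => ?_⟩
      · rw [Item.single_le_single]
        exact ⟨fun h R => (hiff c hc R).mpr h, fun h => (hiff c hc R0).mp (h R0)⟩
      · rw [Item.single_le_single]
        refine ⟨fun h b hb hbc R hR => ?_, fun h => le_of_not_gt fun hlt => h m hm hlt R0 hmF⟩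
        exact absurd ((hiff b hb R).mp hR) (not_le.mpr (hbc.trans_le h))
      · rw [Item.single_le_pair h'.lt]
        exact ⟨fun h => ⟨R0, (hiff x' h'.1 R0).mpr h⟩, fun ⟨R, hR⟩ => (hiff x' h'.1 R).mp hR⟩
      · rw [Item.pair_le_single h'.lt]
        exact ⟨fun h => ⟨R0, fun hR => absurd ((hiff x' h'.1 R0).mp hR) (not_le.mpr h)⟩,
          fun ⟨R, hR⟩ => lt_of_not_ge fun hle => hR ((hiff x' h'.1 R).mpr hle)⟩
    · by_cases hVne : V.Nonempty
      -- An unforced point would bound `V` from below. The infimum of `V` then lies in the closed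
      -- range and is itself forced, being approached by forced points, so `V` would have a minimum.
      · have hall : ∀ c ∈ Set.range f, ∀ R, Forces f c k R := by
          by_contra! hcon
          obtain ⟨c, hc, R, hR⟩ := hcon
          have hlb : ∀ v ∈ V, c ≤ v := fun v hv => le_of_not_ge fun hvc =>
            hR (hup v hv.1 c hc hvc R0 R hv.2)
          obtain ⟨m, hm, hglb⟩ := exists_isGLB_mem hΩ (T := V) (fun v hv => hv.1) hVne hlb
          refine hmin ⟨m, ⟨hm, fun Q hQ hkQ => hglb.2 fun v hv => ?_⟩, hglb.1⟩
          exact hv.2 Q hQ (hkQ.trans (Set.ncard_le_ncard (peaksBelow_mono (hglb.1 hv))))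
        refine ⟨Item.negInf, fun ⟨m, hm⟩ => hmin ⟨m, ⟨hm.1, hall m hm.1 R0⟩, fun v hv => hm.2 hv.1⟩,
          fun c hc => ?_, fun c hc => ?_, fun x' y' h' => ?_, fun x' y' h' => ?_⟩
        · exact iff_of_true (Item.negInf_le _) (hall c hc)
        · refine iff_of_false (Item.not_single_le_negInf c) fun h => hmin ⟨c, ⟨hc, hall c hc R0⟩, ?_⟩
          exact fun v hv => le_of_not_gt fun hlt => h v hv.1 hlt R0 hv.2
        · exact iff_of_true (Item.negInf_le _) ⟨R0, hall x' h'.1 R0⟩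
        · exact iff_of_false (Item.not_pair_le_negInf _ _) fun ⟨R, hR⟩ => hR (hall x' h'.1 R)
      · have hnone : ∀ c ∈ Set.range f, ∀ R, ¬ Forces f c k R := fun c hc R h =>
          hVne ⟨c, hc, hconst c hc R R0 h⟩
        refine ⟨Item.posInf, fun ⟨m, hm⟩ => hnone m hm.1 R0 fun Q _ _ => hm.2 ⟨Q, rfl⟩,
          fun c hc => ?_, fun c hc => ?_, fun x' y' h' => ?_, fun x' y' h' => ?_⟩
        · exact iff_of_false (Item.not_posInf_le_single c) fun h => hnone c hc R0 (h R0)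
        · exact iff_of_true (Item.le_posInf _) fun b hb _ => hnone b hb
        · exact iff_of_false (Item.not_posInf_le_pair _ _) fun ⟨R, hR⟩ => hnone x' h'.1 R hR
        · exact iff_of_true (Item.le_posInf _) ⟨R0, hnone x' h'.1 R0⟩

/-- Every c of the range is the outcome of some `R`, and having all peaks at most c then suffices
under the outside reports of `R`. So no point below the item exists. -/
lemma IsForcingItem.isLowerEnd (hf : IsStrategyProof f) (ha : IsTypeAnonymous f)
    (hΩ : IsClosed (Subtype.val '' Set.range f)) {γ : Item X}
    (h : IsForcingItem f A.ncard γ) (hne : (Set.range f).Nonempty) :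
    IsLowerEnd (Set.range f) γ := by
  have hsome : ∀ c ∈ Set.range f, ∃ R, Forces f c A.ncard R := by
    rintro c ⟨R, hR⟩
    refine ⟨R, hf.forces_of_le ha hΩ ⟨R, hR⟩ (fun _ _ => rfl)
      (Set.ncard_le_ncard peaksBelow_subset) hR.le⟩
  have hleast : ∀ c ∈ Set.range f, Item.single c ≤ γ → IsLeast (Set.range f) c := by
    intro c hc hcγ
    refine ⟨hc, fun b hb => le_of_not_gt fun hlt => ?_⟩
    obtain ⟨R, hR⟩ := hsome b hb
    exact (h.single_le_iff c hc).mp hcγ b hb hlt R hR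
  have hph := h.isPhantom
  cases γ with
  | negInf => exact hph
  | single c => exact hleast c hph (Item.single_le_single.mpr le_rfl)
  | pair x y =>
    exact ⟨hleast x hph.1 ((Item.single_le_pair hph.lt).mpr le_rfl), hph⟩
  | posInf =>
    obtain ⟨c, hc⟩ := hne
    refine hph ⟨c, hc, fun d hd => ?_⟩
    exact (hleast d hd (Item.le_posInf _)).2 hc

end Forcing

/-! ### Pigeonhole bounds on indices. -/

section Counting

/-- This and the next lemma extract a phantom with a large or a small index from a count, so that
the phantoms need not be known to be sorted. -/
lemma exists_le_of_lt_ncard {n m : ℕ} {S : Set (Fin n)} (h : m < S.ncard) :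
    ∃ j ∈ S, m ≤ (j : ℕ) := by
  by_contra! hcon
  have := Set.ncard_le_ncard_of_injOn (t := Set.Iio m) (fun j : Fin n => (j : ℕ))
    (fun j hj => hcon j hj) (fun i _ j _ hij => Fin.ext hij) (Set.finite_Iio m)
  rw [Set.ncard_eq_toFinset_card' (Set.Iio m)] at this
  simp at this
  omega

lemma exists_add_lt_of_lt_ncard {n m : ℕ} {S : Set (Fin n)} (h : m < S.ncard) :
    ∃ j ∈ S, (j : ℕ) + m < n := by
  by_contra! hcon
  have := Set.ncard_le_ncard_of_injOn (t := Set.Iio m) (fun j : Fin n => n - 1 - (j : ℕ))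
    (fun j hj => by have := hcon j hj; have := j.isLt; simp only [Set.mem_Iio]; omega)
    (fun i _ j _ hij => by have := i.isLt; have := j.isLt; simp only at hij; exact Fin.ext (by omega))
    (Set.finite_Iio m)
  rw [Set.ncard_eq_toFinset_card' (Set.Iio m)] at this
  simp at this
  omega

lemma ncard_setOf_val_lt {n m : ℕ} (h : m ≤ n) : {j : Fin n | (j : ℕ) < m}.ncard = m := by
  rw [Set.ncard_eq_toFinset_card']
  simp [Fin.card_filter_val_lt, h]

lemma ncard_setOf_sumElim {α β γ : Type*} [Finite α] [Finite β] (u : α → γ) (v : β → γ)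
    (P : γ → Prop) :
    {s | P (Sum.elim u v s)}.ncard = {i | P (u i)}.ncard + {j | P (v j)}.ncard := by
  have : {s | P (Sum.elim u v s)} = Sum.inl '' {i | P (u i)} ∪ Sum.inr '' {j | P (v j)} := by
    ext s
    cases s <;> simp
  rw [this, Set.ncard_union_eq, Set.ncard_image_of_injective _ Sum.inl_injective,
    Set.ncard_image_of_injective _ Sum.inr_injective]
  rw [Set.disjoint_left]
  rintro _ ⟨i, -, rfl⟩ ⟨j, -, h⟩
  exact Sum.inr_ne_inl h

end Counting

/-! ### Existence and monotonicity of medians. -/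

section Median

variable {X : Set ℝ}

lemma exists_isMedian {ι : Type*} [Finite ι] (b : ι → Item X) {a : ℕ}
    (hodd : Nat.card ι = 2 * a + 1) : ∃ m, IsMedian b m := by
  have : Nonempty ι := by
    by_contra hne
    rw [not_nonempty_iff] at hne
    simp at hodd
  have hS : {i | Nat.card ι + 1 ≤ 2 * {j | b j ≤ b i}.ncard}.Nonempty := by
    obtain ⟨i, hi⟩ := Finite.exists_max fun i => (b i).key
    refine ⟨i, ?_⟩
    have : {j | b j ≤ b i} = Set.univ := Set.eq_univ_of_forall hi
    simp only [Set.mem_ofPred_eq, this, Set.ncard_univ]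
    omega
  -- The median is the least member with enough members below it. If too few were above it, the
  -- largest member strictly below it would also have enough below.
  obtain ⟨i, hi, hmin⟩ := Set.exists_min_image _ (fun i => (b i).key) (Set.toFinite _) hS
  refine ⟨b i, ⟨i, rfl⟩, hi, ?_⟩
  by_contra! hlt
  have hcompl := Set.ncard_add_ncard_compl {j | b i ≤ b j}
  have hne : {j | b i ≤ b j}ᶜ.Nonempty := by
    rw [← Set.ncard_pos]
    omega
  obtain ⟨j, hj, hmax⟩ := Set.exists_max_image _ (fun i => (b i).key) (Set.toFinite _) hne
  refine hj (hmin j ?_)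
  have := Set.ncard_le_ncard (s := {j | b i ≤ b j}ᶜ) (t := {j' | b j' ≤ b j}) hmax
  simp only [Set.mem_ofPred_eq]
  omega

/-- If every item that is at most a median of `b` stays at most that median in `b'`, then
the medians of `b'` are at most that median. -/
lemma IsMedian.le_of_forall {ι : Type*} [Finite ι] {b b' : ι → Item X} {m m' : Item X}
    (h : IsMedian b m) (h' : IsMedian b' m') (hb : ∀ i, b i ≤ m → b' i ≤ m) : m' ≤ m := by
  have h1 : {i | b i ≤ m}.ncard ≤ {i | b' i ≤ m}.ncard := Set.ncard_le_ncard hb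
  have h2 := Set.ncard_union_add_ncard_inter {i | b' i ≤ m} {i | m' ≤ b' i}
  have h3 : ({i | b' i ≤ m} ∪ {i | m' ≤ b' i}).ncard ≤ Nat.card ι := by
    rw [← Set.ncard_univ]
    exact Set.ncard_le_ncard (Set.subset_univ _)
  have h4 := h.2.1
  have h5 := h'.2.2
  have : ({i | b' i ≤ m} ∩ {i | m' ≤ b' i}).Nonempty := by
    rw [← Set.ncard_pos]
    omega
  obtain ⟨i, hi, hi'⟩ := this
  exact Item.le_trans' hi' hi

lemma IsMedian.ge_of_forall {ι : Type*} [Finite ι] {b b' : ι → Item X} {m m' : Item X}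
    (h : IsMedian b m) (h' : IsMedian b' m') (hb : ∀ i, m ≤ b i → m ≤ b' i) : m ≤ m' := by
  have h1 : {i | m ≤ b i}.ncard ≤ {i | m ≤ b' i}.ncard := Set.ncard_le_ncard hb
  have h2 := Set.ncard_union_add_ncard_inter {i | m ≤ b' i} {i | b' i ≤ m'}
  have h3 : ({i | m ≤ b' i} ∪ {i | b' i ≤ m'}).ncard ≤ Nat.card ι := by
    rw [← Set.ncard_univ]
    exact Set.ncard_le_ncard (Set.subset_univ _)
  have h4 := h.2.2
  have h5 := h'.2.1
  have : ({i | m ≤ b' i} ∩ {i | b' i ≤ m'}).Nonempty := by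
    rw [← Set.ncard_pos]
    omega
  obtain ⟨i, hi, hi'⟩ := this
  exact Item.le_trans' hi hi'

end Median

/-! ### From forcing thresholds to the median formula. -/

section PeakVectors

variable {N : Type*} {A : Set N} {X : Set ℝ} {f : Profile A X → X}

lemma IsPeakVector.isBest {Ω : Set X} {R : Profile A X} {p : A → Ω} (hp : IsPeakVector Ω R p)
    (i : A) : (R.pref i).IsBest Ω (p i) := by
  refine ⟨(p i).2, fun y hy => ?_⟩
  by_cases h : y = p i
  · rw [h]
    exact Preference.refl _ _
  · exact (hp i y hy h).1

lemma exists_isPeakVector (hΩ : IsClosed (Subtype.val '' Set.range f)) (R : Profile A X) :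
    ∃ p : A → Set.range f, IsPeakVector (Set.range f) R p := by
  choose p hp using fun i : A => exists_isBest hΩ R i.2
  refine ⟨fun i => ⟨p i, (hp i).1⟩, fun i y hy hne => ⟨(hp i).2 y hy, fun h => hne ?_⟩⟩
  exact (R.pref i).antisymmetric _ _ h ((hp i).2 y hy)

open Classical in
lemma exists_profile_isPeakVector {Ω : Set X} (R : Profile A X) (p : A → Ω) :
    ∃ R' : Profile A X, IsPeakVector Ω R' p := by
  refine ⟨⟨fun i => if h : i ∈ A then peakLeft (p ⟨i, h⟩) else R.pref i, fun i hi => ?_,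
    fun i hi => ?_⟩, fun i y hy hne => ?_⟩
  · simp only [hi, dite_true]
    exact isSinglePeaked_peakLeft _
  · simp only [show i ∉ A from hi, dite_false]
    exact R.dipped i hi
  · simp only [i.2, dite_true]
    have hb := isBest_peakLeft (p i).2
    exact ⟨hb.2 y hy, fun h => hne ((peakLeft _).antisymmetric _ _ h (hb.2 y hy))⟩

lemma IsPeakVector.peaksBelow_eq {Ω : Set X} {R : Profile A X} {p : A → Ω}
    (hp : IsPeakVector Ω R p) (c : X) :
    peaksBelow Ω R c = Subtype.val '' {i : A | (p i : X) ≤ c} := by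
  ext i
  constructor
  · rintro ⟨hi, q, hq, hqc⟩
    exact ⟨⟨i, hi⟩, by rwa [hq.unique (hp.isBest ⟨i, hi⟩)] at hqc, rfl⟩
  · rintro ⟨i, hi, rfl⟩
    exact ⟨i.2, _, hp.isBest i, hi⟩

lemma IsPeakVector.ncard_peaksBelow {Ω : Set X} {R : Profile A X} {p : A → Ω}
    (hp : IsPeakVector Ω R p) (c : X) :
    (peaksBelow Ω R c).ncard = {i : A | (p i : X) ≤ c}.ncard := by
  rw [hp.peaksBelow_eq, Set.ncard_image_of_injective _ Subtype.val_injective]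

/-- No peak lies strictly between x and y, so in `A` preferring x to y means having a peak at most
x. -/
lemma support_eq_ncard_peaksBelow (hΩ : IsClosed (Subtype.val '' Set.range f)) {x y : X}
    (hxy : IsContiguous (Set.range f) x y) (R : Profile A X) :
    support A R x y = (peaksBelow (Set.range f) R x).ncard := by
  unfold support
  congr 1
  ext i
  constructor
  · rintro ⟨hi, hs⟩
    obtain ⟨p, hp⟩ := exists_isBest hΩ R hi
    refine ⟨hi, p, hp, le_of_not_gt fun hlt => ?_⟩
    exact hp.not_rel_of_lt_of_le (R.peaked i hi) hxy.2.1 hxy.1 hxy.lt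
      (hxy.le_of_lt hp.1 hlt) hs.1
  · rintro ⟨hi, p, hp, hpx⟩
    exact ⟨hi, Preference.strict_of_not_rel
      (hp.not_rel_of_le_of_lt (R.peaked i hi) hxy.1 hxy.2.1 hpx hxy.lt)⟩

variable [Finite N]

lemma IsMedian.le_ncard_add {u : A → Item X} {γ : Fin (A.ncard + 1) → Item X} {m : Item X}
    (h : IsMedian (Sum.elim u γ) m) :
    A.ncard + 1 ≤ {i | u i ≤ m}.ncard + {j | γ j ≤ m}.ncard ∧
      A.ncard + 1 ≤ {i | m ≤ u i}.ncard + {j | m ≤ γ j}.ncard := by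
  obtain ⟨-, h1, h2⟩ := h
  rw [ncard_setOf_sumElim u γ (· ≤ m)] at h1
  rw [ncard_setOf_sumElim u γ (m ≤ ·)] at h2
  rw [Nat.card_sum, Nat.card_coe_set_eq, Nat.card_eq_fintype_card, Fintype.card_fin] at h1 h2
  omega

lemma ncard_compl_add {Ω : Set X} (p : A → Ω) (P : X → Prop) :
    {i : A | P (p i)}.ncard + {i : A | ¬ P (p i)}.ncard = A.ncard := by
  have := Set.ncard_add_ncard_compl {i : A | P (p i)}
  rwa [Nat.card_coe_set_eq] at this

variable {γ : Fin (A.ncard + 1) → Item X}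

/-- Some phantom at most x has a forcing number not exceeding the count of peaks at most x, so x is
forced. Were the outcome below x, it would be forced by its own count of peaks, while some phantom
at least x excludes this. -/
lemma IsStrategyProof.eq_of_isMedian_single (hf : IsStrategyProof f) (ha : IsTypeAnonymous f)
    (hΩ : IsClosed (Subtype.val '' Set.range f))
    (hγ : ∀ j : Fin (A.ncard + 1), IsForcingItem f (A.ncard - (j : ℕ)) (γ j)) {R : Profile A X} {p : A → Set.range f}
    (hp : IsPeakVector (Set.range f) R p) {x : X} (hx : x ∈ Set.range f)
    (hm : IsMedian (Sum.elim (fun i : A => Item.single (p i : X)) γ) (Item.single x)) :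
    f R = x := by
  obtain ⟨h1, h2⟩ := hm.le_ncard_add
  simp only [Item.single_le_single] at h1 h2
  apply le_antisymm
  · rw [← hp.ncard_peaksBelow] at h1
    have hle : (peaksBelow (Set.range f) R x).ncard ≤ A.ncard :=
      Set.ncard_le_ncard peaksBelow_subset
    obtain ⟨j, hj, hkj⟩ := exists_le_of_lt_ncard
      (m := A.ncard - (peaksBelow (Set.range f) R x).ncard)
      (S := {j | γ j ≤ Item.single x}) (by omega)
    exact ((hγ j).le_single_iff x hx).mp hj R R (fun _ _ => rfl) (by omega)
  · by_contra! hlt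
    have h3 := ncard_compl_add p (x ≤ ·)
    simp only [not_le] at h3
    obtain ⟨j, hj, hkj⟩ := exists_add_lt_of_lt_ncard
      (m := {i : A | (p i : X) < x}.ncard) (S := {j | Item.single x ≤ γ j}) (by omega)
    refine ((hγ j).single_le_iff x hx).mp hj (f R) ⟨R, rfl⟩ hlt R ?_
    refine hf.forces_of_le ha hΩ ⟨R, rfl⟩ (fun _ _ => rfl) ?_ le_rfl
    rw [hp.ncard_peaksBelow]
    have : {i : A | (p i : X) ≤ f R}.ncard ≤ {i : A | (p i : X) < x}.ncard :=
      Set.ncard_le_ncard fun i hi => lt_of_le_of_lt hi hlt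
    omega

/-- A median at the pair means exactly that the reports outside `A` are decisive at the current
number of peaks. -/
lemma forces_of_isMedian_pair (hγ : ∀ j : Fin (A.ncard + 1), IsForcingItem f (A.ncard - (j : ℕ)) (γ j)) {R : Profile A X}
    {p : A → Set.range f} (hp : IsPeakVector (Set.range f) R p) {x y : X}
    (hxy : IsContiguous (Set.range f) x y)
    (hm : IsMedian (Sum.elim (fun i : A => Item.single (p i : X)) γ) (Item.pair x y)) :
    (∃ R', Forces f x (peaksBelow (Set.range f) R x).ncard R') ∧
      ∃ R', ¬ Forces f x (peaksBelow (Set.range f) R x).ncard R' := by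
  obtain ⟨h1, h2⟩ := hm.le_ncard_add
  simp only [Item.single_le_pair hxy.lt, Item.pair_le_single hxy.lt] at h1 h2
  have h3 := ncard_compl_add p (· ≤ x)
  simp only [not_le] at h3
  rw [← hp.ncard_peaksBelow] at h1 h3
  constructor
  · obtain ⟨j, hj, hkj⟩ := exists_le_of_lt_ncard
      (m := A.ncard - (peaksBelow (Set.range f) R x).ncard)
      (S := {j | γ j ≤ Item.pair x y}) (by omega)
    obtain ⟨R', hR'⟩ := ((hγ j).le_pair_iff x y hxy).mp hj
    exact ⟨R', hR'.mono (by omega)⟩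
  · obtain ⟨j, hj, hkj⟩ := exists_add_lt_of_lt_ncard
      (m := (peaksBelow (Set.range f) R x).ncard) (S := {j | Item.pair x y ≤ γ j}) (by omega)
    obtain ⟨R', hR'⟩ := ((hγ j).pair_le_iff x y hxy).mp hj
    exact ⟨R', fun h => hR' (h.mono (by omega))⟩

/-- Suppose the agents outside `A` have influence at `x` when `k` peaks are at most `x`. Then the
outcome is one of the two contiguous alternatives. -/
lemma IsStrategyProof.eq_left_or_eq_right (hf : IsStrategyProof f) (ha : IsTypeAnonymous f)
    (hΩ : IsClosed (Subtype.val '' Set.range f)) {x y : X}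
    (hxy : IsContiguous (Set.range f) x y) {R R₁ R₂ : Profile A X}
    (h₁ : Forces f x (peaksBelow (Set.range f) R x).ncard R₁)
    (h₂ : ¬ Forces f x (peaksBelow (Set.range f) R x).ncard R₂) :
    (Forces f x (peaksBelow (Set.range f) R x).ncard R → f R = x) ∧
      (¬ Forces f x (peaksBelow (Set.range f) R x).ncard R → f R = y) := by
  have hpb : ∀ Q : Profile A X, peaksBelow (Set.range f) (Profile.mix Aᶜ R Q) x =
      peaksBelow (Set.range f) R x := fun Q =>
    peaksBelow_congr (fun i hi => Profile.mix_of_notMem _ _ (not_not.mpr hi)) x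
  have hmixA : ∀ Q : Profile A X, ∀ i ∈ A, (Profile.mix Aᶜ R Q).pref i = R.pref i := fun Q i hi =>
    Profile.mix_of_notMem _ _ (not_not.mpr hi)
  constructor
  · intro h
    refine (h R (fun _ _ => rfl) le_rfl).antisymm (le_of_not_gt fun hlt => ?_)
    refine hf.not_lt_lt hΩ hxy.1 (hmixA R₂) hlt (lt_of_not_ge fun hle => h₂ ?_)
    exact hf.forces_of_le ha hΩ hxy.1 (fun j hj => Profile.mix_of_mem _ _ hj) (congrArg Set.ncard (hpb R₂)).le hle
  · intro h
    have hlt : x < f R := lt_of_not_ge fun hle =>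
      h (hf.forces_of_le ha hΩ hxy.1 (fun _ _ => rfl) le_rfl hle)
    refine le_antisymm (le_of_not_gt fun hylt => ?_) (hxy.le_of_lt ⟨R, rfl⟩ hlt)
    have h3 : f (Profile.mix Aᶜ R R₁) ≤ x :=
      h₁ _ (fun j hj => Profile.mix_of_mem _ _ hj) (by rw [hpb])
    exact hf.not_lt_lt hΩ hxy.2.1 (fun i hi => (hmixA R₁ i hi).symm) (h3.trans_lt hxy.lt) hylt

/-- After a permutation outside `A`, every supporter of x also supports x in `R'`. When these agents
switch one by one, the outcome could leave x only for y, and only through an agent who gives up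
supporting x. -/
lemma IsStrategyProof.forces_of_support_le (hf : IsStrategyProof f) (ha : IsTypeAnonymous f)
    (hΩ : IsClosed (Subtype.val '' Set.range f)) {x y : X}
    (hxy : IsContiguous (Set.range f) x y) {k : ℕ} {R R' : Profile A X}
    (h : Forces f x k R) (hs : support Aᶜ R x y ≤ support Aᶜ R' x y) : Forces f x k R' := by
  intro Q' hQ' hk
  by_contra! hlt
  obtain ⟨σ, hσ, hσA, hσS⟩ := exists_perm_subset (B := Aᶜ) (fun i hi => hi.1) (fun i hi => hi.1) hs
  have hσ' : ∀ i, σ i ∈ A ↔ i ∈ A := fun i => not_iff_not.mp (hσ i)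
  set Q := Profile.mix Aᶜ Q' R with hQ
  have hpb : peaksBelow (Set.range f) Q x = peaksBelow (Set.range f) Q' x :=
    peaksBelow_congr (fun i hi => Profile.mix_of_notMem _ _ (not_not.mpr hi)) x
  have hQx : f Q ≤ x := h Q (fun j hj => Profile.mix_of_mem _ _ hj) (by rwa [hpb])
  have hσQ : f (Q.permute σ hσ') = f Q := (ha Q _ σ hσ' fun _ => rfl).symm
  have hoff : ∀ j, j ∉ Aᶜ → Q'.pref j = (Q.permute σ hσ').pref j := by
    intro j hj
    change _ = Q.pref (σ j)
    rw [hσA j hj, Profile.mix_of_notMem _ _ hj]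
  have hQA : ∀ j ∈ A, Q'.pref j = Q.pref j := fun j hj =>
    (Profile.mix_of_notMem _ _ (not_not.mpr hj)).symm
  have hQx' : f Q = x := hQx.antisymm (le_of_not_gt fun hlt' =>
    hf.not_lt_lt hΩ hxy.1 hQA hlt' hlt)
  refine hlt.ne' (hf.mem_of_step Aᶜ hoff {x} ?_ (hσQ.trans hQx'))
  rintro i hi z rfl P hP h1 h2
  have hPA : ∀ j ∈ A, Q'.pref j = P.pref j := fun j hj => by
    rw [hP j (not_not.mpr hj), hoff j (not_not.mpr hj)]
  by_contra hPz
  rcases lt_or_gt_of_ne hPz with hPx | hPx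
  · exact hf.not_lt_lt hΩ hxy.1 hPA hPx hlt
  have hPy : f P = y := by
    refine le_antisymm (le_of_not_gt fun hlt' => ?_) (hxy.le_of_lt ⟨P, rfl⟩ hPx)
    exact hf.not_lt_lt hΩ hxy.2.1 (R := Q) (fun j hj => by rw [← hPA j hj, hQA j hj])
      (hQx'.trans_lt hxy.lt) hlt'
  rw [hPy] at h1 h2
  have hiA : σ i ∈ Aᶜ := (hσ i).mpr hi
  change (Q.pref (σ i)).rel z y at h1
  rw [Profile.mix_of_mem _ _ hiA] at h1
  rw [hQ' i hi] at h2
  refine (hσS i ⟨hiA, h1, fun h1' => ?_⟩).2.2 h2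
  exact hxy.lt.ne ((R.pref (σ i)).antisymmetric _ _ h1 h1')

end PeakVectors

/-! ### Double-quotas, and the construction of the two-step rule. -/

section Quotas

variable {N : Type*} {A : Set N} {X : Set ℝ} {f : Profile A X → X}

/-- The least number of supporters of `x` outside `A` that makes the outcome at most `x` when `k`
peaks are at most `x`. -/
noncomputable def dippedQuota (f : Profile A X → X) (x y : X) (k : ℕ) : ℕ :=
  sInf {s | ∃ R, Forces f x k R ∧ support Aᶜ R x y = s}

lemma dippedQuota_le {x y : X} {k : ℕ} {R : Profile A X} (h : Forces f x k R) :
    dippedQuota f x y k ≤ support Aᶜ R x y :=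
  Nat.sInf_le ⟨R, h, rfl⟩

/-- The hypothesis matters: for an empty set the infimum is 0, which would be a spurious quota. -/
lemma exists_support_eq_dippedQuota {x y : X} {k : ℕ} (h : ∃ R, Forces f x k R) :
    ∃ R, Forces f x k R ∧ support Aᶜ R x y = dippedQuota f x y k := by
  obtain ⟨R, hR⟩ := h
  exact Nat.sInf_mem (s := {s | ∃ R, Forces f x k R ∧ support Aᶜ R x y = s}) ⟨_, R, hR, rfl⟩

lemma dippedQuota_anti {x y : X} {k k' : ℕ} (hk : k ≤ k') (h : ∃ R, Forces f x k R) :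
    dippedQuota f x y k' ≤ dippedQuota f x y k := by
  obtain ⟨R, hR, hs⟩ := exists_support_eq_dippedQuota (y := y) h
  exact hs ▸ dippedQuota_le (hR.mono hk)

variable [Finite N]

lemma IsStrategyProof.dippedQuota_le_iff (hf : IsStrategyProof f) (ha : IsTypeAnonymous f)
    (hΩ : IsClosed (Subtype.val '' Set.range f)) {x y : X}
    (hxy : IsContiguous (Set.range f) x y) {k : ℕ} (h : ∃ R, Forces f x k R) {R : Profile A X} :
    dippedQuota f x y k ≤ support Aᶜ R x y ↔ Forces f x k R := by
  refine ⟨fun hle => ?_, dippedQuota_le⟩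
  obtain ⟨R', hR', hs⟩ := exists_support_eq_dippedQuota (y := y) h
  exact hf.forces_of_support_le ha hΩ hxy hR' (hs.trans_le hle)

theorem IsStrategyProof.exists_quotas (hf : IsStrategyProof f) (ha : IsTypeAnonymous f)
    (hΩ : IsClosed (Subtype.val '' Set.range f)) {γ : Fin (A.ncard + 1) → Item X}
    (hγ : ∀ j : Fin (A.ncard + 1), IsForcingItem f (A.ncard - (j : ℕ)) (γ j)) {x y : X}
    (hxy : IsContiguous (Set.range f) x y)
    (hne : ∃ k ≤ A.ncard, (∃ R, Forces f x k R) ∧ ∃ R, ¬ Forces f x k R) :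
    ∃ Q : Finset (ℕ × ℕ), IsMinimalDoubleQuotas γ x y Q ∧
      ∀ k ≤ A.ncard, (∃ R, Forces f x k R) → (∃ R, ¬ Forces f x k R) → ∀ R,
        ((∃ q ∈ Q, q.1 ≤ k ∧ q.2 ≤ support Aᶜ R x y) ↔ Forces f x k R) := by
  classical
  set K : Finset ℕ := (Finset.range (A.ncard + 1)).filter
    fun k => (∃ R, Forces f x k R) ∧ ∃ R, ¬ Forces f x k R with hK
  have memK : ∀ k, k ∈ K ↔ k ≤ A.ncard ∧ (∃ R, Forces f x k R) ∧ ∃ R, ¬ Forces f x k R := by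
    intro k
    rw [hK, Finset.mem_filter, Finset.mem_range, Nat.lt_succ_iff]
  set G : Finset (ℕ × ℕ) := K.image fun k => (k, dippedQuota f x y k) with hG
  have memG : ∀ q, q ∈ G ↔ q.1 ∈ K ∧ q.2 = dippedQuota f x y q.1 := by
    rintro ⟨k, s⟩
    simp only [hG, Finset.mem_image, Prod.mk.injEq]
    constructor
    · rintro ⟨k, hk, rfl, rfl⟩
      exact ⟨hk, rfl⟩
    · rintro ⟨hk, rfl⟩
      exact ⟨k, hk, rfl, rfl⟩
  -- `G` is the graph of the quota over the counts k at which the outside agents are decisive. Its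
  -- minimal elements form an antichain and define the same condition.
  set Q : Finset (ℕ × ℕ) := G.filter fun q => Minimal (· ∈ G) q with hQ
  have memQ : ∀ q, q ∈ Q ↔ Minimal (· ∈ G) q := by
    intro q
    rw [hQ, Finset.mem_filter]
    exact ⟨fun h => h.2, fun h => ⟨h.prop, h⟩⟩
  refine ⟨Q, ⟨?_, ?_, ?_, ?_⟩, ?_⟩
  · calc Q.card ≤ G.card := Finset.card_filter_le _ _
      _ ≤ K.card := Finset.card_image_le
      _ = (K : Set ℕ).ncard := (Set.ncard_coe_finset K).symm
      _ ≤ ((fun j : Fin (A.ncard + 1) => A.ncard - (j : ℕ)) ''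
          {j | γ j = Item.pair x y}).ncard := by
        refine Set.ncard_le_ncard fun k hk => ?_
        obtain ⟨hkA, h1, h2⟩ := (memK k).mp hk
        -- Each decisive k has its own phantom, at index a - k, equal to the pair; hence at most M
        -- quotas.
        refine ⟨⟨A.ncard - k, by omega⟩, ?_, by simp only; omega⟩
        have hj := hγ ⟨A.ncard - k, by omega⟩
        rw [show A.ncard - ((⟨A.ncard - k, by omega⟩ : Fin (A.ncard + 1)) : ℕ) = k by
          simp only; omega] at hj
        refine Item.eq_of_le_of_le hxy.lt (fun x' y' h' => ?_) ((hj.le_pair_iff x y hxy).mpr h1)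
          ((hj.pair_le_iff x y hxy).mpr h2)
        have := hj.isPhantom
        rw [h'] at this
        exact this.lt
      _ ≤ _ := Set.ncard_image_le
  · intro q hq
    obtain ⟨hqK, hq2⟩ := (memG q).mp ((memQ q).mp hq).prop
    obtain ⟨-, h1, R, hR⟩ := (memK _).mp hqK
    rw [hq2]
    -- A zero quota would be met by every profile, although forcing fails at `R`.
    by_contra! hlt
    refine hR ((hf.dippedQuota_le_iff ha hΩ hxy h1).mp ?_)
    exact (Nat.lt_one_iff.mp hlt).trans_le (Nat.zero_le _)
  · intro q hq q' hq' hne hle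
    exact hne (((memQ q').mp hq').eq_of_le ((memQ q).mp hq).prop hle)
  · obtain ⟨k, hk, h1, R, hR⟩ := hne
    have hex : ∃ k, ∃ R, Forces f x k R := ⟨k, h1⟩
    -- The least k that can force x has the smallest first coordinate, so its quota is minimal. A
    -- phantom with index j is at most the pair exactly when j ≤ a - m, which gives a + 1 - m such
    -- phantoms.
    set m := Nat.find hex with hm
    have hmk : m ≤ k := Nat.find_min' hex h1
    have hmem : m ∈ K := (memK m).mpr
      ⟨hmk.trans hk, Nat.find_spec hex, R, fun h => hR (h.mono hmk)⟩
    refine ⟨(m, dippedQuota f x y m), (memQ _).mpr ⟨(memG _).mpr ⟨hmem, rfl⟩, ?_⟩, ?_⟩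
    · intro q hq hle
      obtain ⟨hqK, hq2⟩ := (memG q).mp hq
      have : q.1 = m := le_antisymm hle.1 (Nat.find_min' hex ((memK _).mp hqK).2.1)
      rw [this] at hq2
      exact ⟨this.ge, hq2.ge⟩
    · have : {j : Fin (A.ncard + 1) | γ j ≤ Item.pair x y} =
          {j : Fin (A.ncard + 1) | (j : ℕ) < A.ncard + 1 - m} := by
        ext j
        have hj := j.isLt
        simp only [Set.mem_ofPred_eq, (hγ j).le_pair_iff x y hxy]
        constructor
        · intro h
          have : m ≤ A.ncard - (j : ℕ) := Nat.find_min' hex h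
          omega
        · intro h
          obtain ⟨R', hR'⟩ := Nat.find_spec hex
          exact ⟨R', hR'.mono (by omega)⟩
      rw [this, ncard_setOf_val_lt (by omega)]
      simp only
      omega
  · intro k hk h1 h2 R
    rw [← hf.dippedQuota_le_iff ha hΩ hxy h1]
    constructor
    · rintro ⟨q, hq, hq1, hq2⟩
      obtain ⟨hqK, hq3⟩ := (memG q).mp ((memQ q).mp hq).prop
      exact (dippedQuota_anti hq1 ((memK _).mp hqK).2.1).trans (hq3 ▸ hq2)
    · intro h
      obtain ⟨q, hqle, hq⟩ := G.exists_le_minimal ((memG (k, dippedQuota f x y k)).mpr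
        ⟨(memK k).mpr ⟨hk, h1, h2⟩, rfl⟩)
      exact ⟨q, (memQ q).mpr hq, hqle.1, hqle.2.trans h⟩

/-- Strategy-proof and type-anonymous rules are two-step rules. -/
theorem IsStrategyProof.isTwoStepRule (hf : IsStrategyProof f) (ha : IsTypeAnonymous f)
    (hΩ : IsClosed (Subtype.val '' Set.range f)) (hne : (Set.range f).Nonempty) :
    IsTwoStepRule f := by
  classical
  choose γ hγ using fun j : Fin (A.ncard + 1) =>
    hf.exists_isForcingItem ha hΩ hne (k := A.ncard - (j : ℕ)) (Nat.sub_le _ _)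
  have hodd : Nat.card (A ⊕ Fin (A.ncard + 1)) = 2 * A.ncard + 1 := by
    rw [Nat.card_sum, Nat.card_coe_set_eq, Nat.card_eq_fintype_card, Fintype.card_fin]
    omega
  choose med hmed using fun p : A → Set.range f =>
    exists_isMedian (Sum.elim (fun i : A => Item.single (p i : X)) γ) hodd
  have hlower : IsLowerEnd (Set.range f) (γ 0) :=
    IsForcingItem.isLowerEnd hf ha hΩ (by simpa using hγ 0) hne
  have hupper : IsUpperEnd (Set.range f) (γ (Fin.last A.ncard)) :=
    IsForcingItem.isUpperEnd (by simpa using hγ (Fin.last A.ncard)) hne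
  have hfirst : ∀ p, IsFirstStepOutcome (Set.range f) (med p) := by
    intro p
    obtain ⟨s, hs⟩ := (hmed p).1
    have hcount := (hmed p).le_ncard_add
    rcases s with i | j
    · simp only [Sum.elim_inl] at hs
      rw [← hs]
      exact (p i).2
    · simp only [Sum.elim_inr] at hs
      have hph := (hγ j).isPhantom
      rw [hs] at hph
      cases hm : med p with
      | single x => rw [hm] at hph; exact hph
      | pair x y => rw [hm] at hph; exact hph
      -- No peak is at most -∞, so a median of -∞ would need all a + 1 phantoms there, including the
      -- last, which is an upper end.
      | negInf =>
        rw [hm] at hcount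
        have h1 := hcount.1
        simp only [Item.not_single_le_negInf, Set.ofPred_false, Set.ncard_empty, zero_add] at h1
        obtain ⟨j, hj, hlt⟩ := exists_le_of_lt_ncard (m := A.ncard) h1
        have : j = Fin.last A.ncard := Fin.ext (by simp; omega)
        subst this
        simp only [Set.mem_ofPred_eq] at hj
        cases hg : γ (Fin.last A.ncard) with
        | negInf => rw [hg] at hupper; exact hupper
        | single x => rw [hg] at hj; exact Item.not_single_le_negInf x hj
        | pair x y => rw [hg] at hj; exact Item.not_pair_le_negInf x y hj
        | posInf => rw [hg] at hj; exact Item.not_posInf_le_negInf hj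
      | posInf =>
        rw [hm] at hcount
        have h1 := hcount.2
        simp only [Item.not_posInf_le_single, Set.ofPred_false, Set.ncard_empty, zero_add] at h1
        obtain ⟨j, hj, hlt⟩ := exists_add_lt_of_lt_ncard (m := A.ncard) h1
        have : j = 0 := Fin.ext (by change (j : ℕ) = 0; omega)
        subst this
        simp only [Set.mem_ofPred_eq] at hj
        cases hg : γ 0 with
        | negInf => rw [hg] at hj; exact Item.not_posInf_le_negInf hj
        | single x => rw [hg] at hj; exact Item.not_posInf_le_single x hj
        | pair x y => rw [hg] at hj; exact Item.not_posInf_le_pair x y hj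
        | posInf => rw [hg] at hlower; exact hlower
  have hpair : ∀ R p x y, IsPeakVector (Set.range f) R p → med p = Item.pair x y →
      IsContiguous (Set.range f) x y ∧
      (∃ R', Forces f x (peaksBelow (Set.range f) R x).ncard R') ∧
      ∃ R', ¬ Forces f x (peaksBelow (Set.range f) R x).ncard R' := by
    intro R p x y hp hm
    have hxy := hfirst p
    rw [hm] at hxy
    exact ⟨hxy, forces_of_isMedian_pair hγ hp hxy (hm ▸ hmed p)⟩
  have hle : ∀ (R : Profile A X) x, (peaksBelow (Set.range f) R x).ncard ≤ A.ncard := fun R x =>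
    Set.ncard_le_ncard peaksBelow_subset
  -- This form keeps the method within {x, y} at every profile; where the median is the pair it
  -- agrees with f.
  refine ⟨γ, med, fun x y R => if f R = x then x else y,
    ⟨fun j => (hγ j).isPhantom, hlower, hupper, hfirst, hmed⟩, ?_, ?_⟩
  · rintro x y ⟨p, hp⟩
    refine ⟨fun R => ?_, ?_⟩
    · by_cases h : f R = x
      · exact Or.inl (if_pos h)
      · exact Or.inr (if_neg h)
    · obtain ⟨_, R, -⟩ := id hne
      obtain ⟨R0, hR0⟩ := exists_profile_isPeakVector R p
      obtain ⟨hxy, h1, h2⟩ := hpair R0 p x y hR0 hp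
      obtain ⟨Q, hQ, hQF⟩ := hf.exists_quotas ha hΩ hγ hxy ⟨_, hle R0 x, h1, h2⟩
      refine ⟨Q, hQ, fun R p hp hm => ?_⟩
      obtain ⟨-, ⟨R₁, h1⟩, R₂, h2⟩ := hpair R p x y hp hm
      rw [support_eq_ncard_peaksBelow hΩ hxy, hQF _ (hle R x) ⟨R₁, h1⟩ ⟨R₂, h2⟩ R]
      obtain ⟨h3, h4⟩ := hf.eq_left_or_eq_right ha hΩ hxy h1 h2
      refine ⟨fun h => if_pos (h3 h), fun h => if_neg ?_⟩
      rw [h4 h]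
      exact hxy.lt.ne'
  · intro R p hp
    refine ⟨fun x hm => ?_, fun x y hm => ?_⟩
    · have hx := hfirst p
      rw [hm] at hx
      exact hf.eq_of_isMedian_single ha hΩ hγ hp hx (hm ▸ hmed p)
    · obtain ⟨hxy, ⟨R₁, h1⟩, R₂, h2⟩ := hpair R p x y hp hm
      obtain ⟨h3, h4⟩ := hf.eq_left_or_eq_right ha hΩ hxy h1 h2
      change f R = if f R = x then x else y
      split_ifs with h
      · exact h
      · exact h4 fun hF => h (h3 hF)

end Quotas

/-! ### Two-step rules are group strategy-proof and type-anonymous. -/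

section TwoStep

variable {N : Type*} {A : Set N} {X : Set ℝ} {f : Profile A X → X}

/-- A single-peaked agent who strictly gains from a move to the right has a peak to the right. -/
lemma Preference.IsBest.lt_of_not_rel {P : Preference X} (hP : P.IsSinglePeaked) {Ω : Set X}
    {p x y : X} (hp : P.IsBest Ω p) (hx : x ∈ Ω) (hy : y ∈ Ω) (hxy : x < y)
    (h : ¬ P.rel x y) : x < p :=
  lt_of_not_ge fun hle => h
    ((P.complete x y).resolve_right (hp.not_rel_of_le_of_lt hP hx hy hle hxy))

lemma Preference.IsBest.gt_of_not_rel {P : Preference X} (hP : P.IsSinglePeaked) {Ω : Set X}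
    {p x y : X} (hp : P.IsBest Ω p) (hx : x ∈ Ω) (hy : y ∈ Ω) (hyx : y < x)
    (h : ¬ P.rel x y) : p < x :=
  lt_of_not_ge fun hle => h
    ((P.complete x y).resolve_right (hp.not_rel_of_lt_of_le hP hx hy hyx hle))

lemma support_le_support [Finite N] (S : Set N) {R R' : Profile A X} {x y : X}
    (h : ∀ i ∈ S, (R.pref i).strict x y → (R'.pref i).strict x y) :
    support S R x y ≤ support S R' x y :=
  Set.ncard_le_ncard fun i hi => ⟨hi.1, h i hi.1 hi.2⟩

lemma support_eq_of_perm {S : Set N} {R R' : Profile A X} {σ : Equiv.Perm N}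
    (hσ : ∀ i, σ i ∈ S ↔ i ∈ S) (hR : ∀ i, R'.pref i = R.pref (σ i)) (x y : X) :
    support S R x y = support S R' x y := by
  unfold support
  rw [← Set.ncard_image_of_injective {i ∈ S | (R'.pref i).strict x y} σ.injective]
  congr 1
  ext i
  constructor
  · rintro ⟨hi, h⟩
    refine ⟨σ.symm i, ⟨(hσ _).mp (by simpa using hi), ?_⟩, by simp⟩
    rw [hR]
    simpa using h
  · rintro ⟨j, ⟨hj, h⟩, rfl⟩
    exact ⟨(hσ j).mpr hj, hR j ▸ h⟩

variable [Finite N]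

/-- Two-step rules are group strategy-proof. -/
theorem IsTwoStepRule.isGroupStrategyProof (hΩ : IsClosed (Subtype.val '' Set.range f))
    (h : IsTwoStepRule f) : IsGroupStrategyProof f := by
  obtain ⟨γ, med, t, ⟨-, -, -, hfirst, hmed⟩, ht, hrule⟩ := h
  have houtcome : ∀ (R : Profile A X) p, IsPeakVector (Set.range f) R p → ∀ x y,
      med p = Item.pair x y → f R = x ∨ f R = y := by
    intro R p hp x y hm
    rw [(hrule R p hp).2 x y hm]
    exact (ht x y ⟨p, hm⟩).1 R
  intro R R' S hS hoff
  by_contra! hgain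
  obtain ⟨p, hp⟩ := exists_isPeakVector hΩ R
  obtain ⟨p', hp'⟩ := exists_isPeakVector hΩ R'
  have hpp' : ∀ i : A, (i : N) ∉ S → p' i = p i := by
    intro i hi
    have := hp'.isBest i
    rw [hoff i hi] at this
    exact Subtype.ext (this.unique (hp.isBest i))
  have hcont : ∀ p x y, med p = Item.pair x y → IsContiguous (Set.range f) x y := by
    intro p x y hm
    have := hfirst p
    rwa [hm] at this
  have hne : f R ≠ f R' := by
    obtain ⟨i, hi⟩ := hS
    intro heq
    exact hgain i hi (heq ▸ Preference.refl _ _)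
  rcases lt_or_gt_of_ne hne with hlt | hlt
  · have hpeak : ∀ i : A, (i : N) ∈ S → f R < p i := fun i hi =>
      (hp.isBest i).lt_of_not_rel (R.peaked i i.2) ⟨R, rfl⟩ ⟨R', rfl⟩ hlt (hgain i hi)
    -- The peaks of gainers lie above `f R`, hence are not among the items at most the median; those
    -- items are therefore unaffected by the misreport.
    have hmm : (∀ z : X, Item.single z ≤ med p → z ≤ f R) → med p' ≤ med p := by
      intro hz
      refine (hmed p).le_of_forall (hmed p') ?_
      rintro (i | j) hi
      · by_cases hiS : (i : N) ∈ S
        · exact absurd (hz _ hi) (not_le.mpr (hpeak i hiS))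
        · simpa only [Sum.elim_inl, hpp' i hiS] using hi
      · exact hi
    cases hm : med p with
    | negInf => have := hfirst p; rw [hm] at this; exact this
    | posInf => have := hfirst p; rw [hm] at this; exact this
    | single x =>
      have hx : f R = x := (hrule R p hp).1 x hm
      have hle := hmm fun z hz => by rw [hm, Item.single_le_single] at hz; rwa [hx]
      rw [hm] at hle
      cases hm' : med p' with
      | negInf => have := hfirst p'; rw [hm'] at this; exact this
      | posInf => have := hfirst p'; rw [hm'] at this; exact this
      | single x' =>
        rw [hm', Item.single_le_single, ← hx, ← (hrule R' p' hp').1 x' hm'] at hle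
        exact absurd hlt (not_lt.mpr hle)
      | pair x' y' =>
        have hc := hcont p' x' y' hm'
        rw [hm', Item.pair_le_single hc.lt] at hle
        have hy' : y' ≤ f R := hc.le_of_lt ⟨R, rfl⟩ (hx ▸ hle)
        rcases houtcome R' p' hp' x' y' hm' with h' | h'
        · exact absurd hlt (not_lt.mpr (h' ▸ hc.lt.le.trans hy'))
        · exact absurd hlt (not_lt.mpr (h' ▸ hy'))
    | pair x y =>
      have hc := hcont p x y hm
      have hxR : x ≤ f R := by
        rcases houtcome R p hp x y hm with h' | h' <;> rw [h']
        exact hc.lt.le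
      have hle := hmm fun z hz => by
        rw [hm, Item.single_le_pair hc.lt] at hz
        exact hz.trans hxR
      rw [hm] at hle
      cases hm' : med p' with
      | negInf => have := hfirst p'; rw [hm'] at this; exact this
      | posInf => have := hfirst p'; rw [hm'] at this; exact this
      | single x' =>
        rw [hm', Item.single_le_pair hc.lt, ← (hrule R' p' hp').1 x' hm'] at hle
        exact absurd hlt (not_lt.mpr (hle.trans hxR))
      | pair x' y' =>
        have hc' := hcont p' x' y' hm'
        have hR' := houtcome R' p' hp' x' y' hm'
        rw [hm', Item.pair_le_pair] at hle
        rcases hle with hle | ⟨rfl, -⟩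
        · have := hc'.le_of_lt hc.1 hle
          rcases hR' with h' | h'
          · exact absurd hlt (not_lt.mpr (h' ▸ hle.le.trans hxR))
          · exact absurd hlt (not_lt.mpr (h' ▸ this.trans hxR))
        · obtain rfl : y' = y :=
            le_antisymm (hc'.le_of_lt hc.2.1 hc.lt) (hc.le_of_lt hc'.2.1 hc'.lt)
          have hR := houtcome R p hp x' y' hm
          have hxy := hc.lt
          have hRx : f R = x' := by grind
          have hRy : f R' = y' := by grind
          obtain ⟨Q, -, hQ⟩ := (ht x' y' ⟨p, hm⟩).2
          have h1 := (hQ R p hp hm).2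
          have h2 := (hQ R' p' hp' hm').1
          rw [← (hrule R p hp).2 x' y' hm, hRx] at h1
          rw [← (hrule R' p' hp').2 x' y' hm', hRy] at h2
          have hQR := not_not.mp fun hn => hxy.ne (h1 hn)
          obtain ⟨q, hq, hq1, hq2⟩ := hQR
          -- Gainers from x' to y' did not support x', so all its supporters are outside `S` and
          -- keep their reports; the quota met at `R` is still met at `R'`.
          have hkeep : ∀ i, (R.pref i).strict x' y' → (R'.pref i).strict x' y' := by
            intro i hi
            by_cases hiS : i ∈ S
            · exact absurd hi.1 (by have := hgain i hiS; rwa [hRx, hRy] at this)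
            · rwa [hoff i hiS]
          exact hxy.ne' (h2 ⟨q, hq, hq1.trans (support_le_support _ fun i _ => hkeep i),
            hq2.trans (support_le_support _ fun i _ => hkeep i)⟩)
  · have hpeak : ∀ i : A, (i : N) ∈ S → (p i : X) < f R := fun i hi =>
      (hp.isBest i).gt_of_not_rel (R.peaked i i.2) ⟨R, rfl⟩ ⟨R', rfl⟩ hlt (hgain i hi)
    have hmm : (∀ z ∈ Set.range f, med p ≤ Item.single z → f R ≤ z) → med p ≤ med p' := by
      intro hz
      refine (hmed p).ge_of_forall (hmed p') ?_
      rintro (i | j) hi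
      · by_cases hiS : (i : N) ∈ S
        · exact absurd (hz _ (p i).2 hi) (not_le.mpr (hpeak i hiS))
        · simpa only [Sum.elim_inl, hpp' i hiS] using hi
      · exact hi
    cases hm : med p with
    | negInf => have := hfirst p; rw [hm] at this; exact this
    | posInf => have := hfirst p; rw [hm] at this; exact this
    | single x =>
      have hx : f R = x := (hrule R p hp).1 x hm
      have hle := hmm fun z _ hz => by rw [hm, Item.single_le_single] at hz; rwa [hx]
      rw [hm] at hle
      cases hm' : med p' with
      | negInf => have := hfirst p'; rw [hm'] at this; exact this
      | posInf => have := hfirst p'; rw [hm'] at this; exact this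
      | single x' =>
        rw [hm', Item.single_le_single, ← hx, ← (hrule R' p' hp').1 x' hm'] at hle
        exact absurd hlt (not_lt.mpr hle)
      | pair x' y' =>
        have hc := hcont p' x' y' hm'
        rw [hm', Item.single_le_pair hc.lt, ← hx] at hle
        rcases houtcome R' p' hp' x' y' hm' with h' | h'
        · exact absurd hlt (not_lt.mpr (h' ▸ hle))
        · exact absurd hlt (not_lt.mpr (h' ▸ hle.trans hc.lt.le))
    | pair x y =>
      have hc := hcont p x y hm
      have hRy : f R ≤ y := by
        rcases houtcome R p hp x y hm with h' | h' <;> rw [h']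
        exact hc.lt.le
      have hle := hmm fun z hzΩ hz => by
        rw [hm, Item.pair_le_single hc.lt] at hz
        exact hRy.trans (hc.le_of_lt hzΩ hz)
      rw [hm] at hle
      cases hm' : med p' with
      | negInf => have := hfirst p'; rw [hm'] at this; exact this
      | posInf => have := hfirst p'; rw [hm'] at this; exact this
      | single x' =>
        have hx' : x' ∈ Set.range f := by have := hfirst p'; rwa [hm'] at this
        rw [hm', Item.pair_le_single hc.lt] at hle
        have := hc.le_of_lt hx' hle
        rw [← (hrule R' p' hp').1 x' hm'] at this
        exact absurd hlt (not_lt.mpr (hRy.trans this))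
      | pair x' y' =>
        have hc' := hcont p' x' y' hm'
        have hR' := houtcome R' p' hp' x' y' hm'
        rw [hm', Item.pair_le_pair] at hle
        rcases hle with hle | ⟨rfl, -⟩
        · have := hRy.trans (hc.le_of_lt hc'.1 hle)
          rcases hR' with h' | h'
          · exact absurd hlt (not_lt.mpr (h' ▸ this))
          · exact absurd hlt (not_lt.mpr (h' ▸ this.trans hc'.lt.le))
        · obtain rfl : y' = y :=
            le_antisymm (hc'.le_of_lt hc.2.1 hc.lt) (hc.le_of_lt hc'.2.1 hc'.lt)
          have hR := houtcome R p hp x y' hm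
          have hxy := hc.lt
          have hRy : f R = y' := by grind
          have hRx : f R' = x := by grind
          obtain ⟨Q, -, hQ⟩ := (ht x y' ⟨p, hm⟩).2
          have h1 := (hQ R p hp hm).1
          have h2 := (hQ R' p' hp' hm').2
          rw [← (hrule R p hp).2 x y' hm, hRy] at h1
          rw [← (hrule R' p' hp').2 x y' hm', hRx] at h2
          have hQR := not_not.mp fun hn => hxy.ne (h2 hn)
          obtain ⟨q, hq, hq1, hq2⟩ := hQR
          -- Here the roles are reversed: gainers from y' to x already support x truthfully, so the
          -- quota met at `R'` was met at `R`.
          have hkeep : ∀ i, (R'.pref i).strict x y' → (R.pref i).strict x y' := by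
            intro i hi
            by_cases hiS : i ∈ S
            · exact Preference.strict_of_not_rel (by have := hgain i hiS; rwa [hRx, hRy] at this)
            · rwa [← hoff i hiS]
          exact hxy.ne' (h1 ⟨q, hq, hq1.trans (support_le_support _ fun i _ => hkeep i),
            hq2.trans (support_le_support _ fun i _ => hkeep i)⟩)

/-- Antisymmetry fails for arbitrary items: a degenerate pair (x, x) has the same key as the point
x. Contiguity excludes this. -/
lemma IsFirstStepOutcome.eq_of_le_of_le {Ω : Set X} {α β : Item X}
    (hα : IsFirstStepOutcome Ω α) (hβ : IsFirstStepOutcome Ω β) (h : α ≤ β) (h' : β ≤ α) :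
    α = β := by
  cases β with
  | negInf => exact hβ.elim
  | posInf => exact hβ.elim
  | pair x y =>
    refine Item.eq_of_le_of_le hβ.lt (fun x' y' h' => ?_) h h'
    rw [h'] at hα
    exact hα.lt
  | single x =>
    cases α with
    | negInf => exact hα.elim
    | posInf => exact hα.elim
    | single x' =>
      rw [Item.single_le_single] at h h'
      rw [h.antisymm h']
    | pair x' y' =>
      rw [Item.pair_le_single hα.lt] at h
      rw [Item.single_le_pair hα.lt] at h'
      exact absurd h (not_lt.mpr h')

/-- Two-step rules are type-anonymous. -/
theorem IsTwoStepRule.isTypeAnonymous (hΩ : IsClosed (Subtype.val '' Set.range f))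
    (h : IsTwoStepRule f) : IsTypeAnonymous f := by
  obtain ⟨γ, med, t, ⟨-, -, -, hfirst, hmed⟩, ht, hrule⟩ := h
  intro R R' σ hσ hR
  obtain ⟨p, hp⟩ := exists_isPeakVector hΩ R
  set p' : A → Set.range f := fun i => p ⟨σ i, (hσ i).mpr i.2⟩ with hp'_def
  have hp' : IsPeakVector (Set.range f) R' p' := by
    intro i y hy hne
    rw [hR]
    exact hp ⟨σ i, (hσ i).mpr i.2⟩ y hy hne
  set e : A ⊕ Fin (A.ncard + 1) ≃ A ⊕ Fin (A.ncard + 1) :=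
    Equiv.sumCongr (σ.subtypeEquiv fun i => (hσ i).symm) (Equiv.refl _) with he
  have hcomp : ∀ s, Sum.elim (fun i : A => Item.single (p' i : X)) γ s =
      Sum.elim (fun i : A => Item.single (p i : X)) γ (e s) := by
    rintro (i | j) <;> rfl
  have hmed' : IsMedian (Sum.elim (fun i : A => Item.single (p i : X)) γ) (med p') := by
    obtain ⟨⟨s, hs⟩, h1, h2⟩ := hmed p'
    have hcard : ∀ P : Item X → Prop,
        {s | P (Sum.elim (fun i : A => Item.single (p' i : X)) γ s)}.ncard =
          {s | P (Sum.elim (fun i : A => Item.single (p i : X)) γ s)}.ncard := by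
      intro P
      rw [← Set.ncard_image_of_injective _ e.injective]
      congr 1
      ext s
      simp only [Set.mem_image, Set.mem_ofPred_eq, hcomp]
      exact ⟨fun ⟨r, hr, hrs⟩ => hrs ▸ hr, fun hr => ⟨e.symm s, by simpa using hr, by simp⟩⟩
    refine ⟨⟨e s, by rw [← hcomp, hs]⟩, ?_, ?_⟩
    · rwa [hcard (· ≤ med p')] at h1
    · rwa [hcard (med p' ≤ ·)] at h2
  -- Both are medians of the same family, and two medians of one family bound each other.
  have hm : med p' = med p := (hfirst p').eq_of_le_of_le (hfirst p)
    ((hmed p).le_of_forall hmed' fun _ h => h) (hmed'.le_of_forall (hmed p) fun _ h => h)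
  cases hmp : med p with
  | negInf => exact absurd (hfirst p) (by rw [hmp]; exact id)
  | posInf => exact absurd (hfirst p) (by rw [hmp]; exact id)
  | single x => rw [(hrule R p hp).1 x hmp, (hrule R' p' hp').1 x (hm.trans hmp)]
  | pair x y =>
    rw [(hrule R p hp).2 x y hmp, (hrule R' p' hp').2 x y (hm.trans hmp)]
    obtain ⟨Q, -, hQ⟩ := (ht x y ⟨p, hmp⟩).2
    have h1 := hQ R p hp hmp
    have h2 := hQ R' p' hp' (hm.trans hmp)
    rw [← support_eq_of_perm (S := A) hσ hR,
      ← support_eq_of_perm (S := Aᶜ) (fun i => not_congr (hσ i)) hR] at h2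
    by_cases hq : ∃ q ∈ Q, q.1 ≤ support A R x y ∧ q.2 ≤ support Aᶜ R x y
    · rw [h1.1 hq, h2.1 hq]
    · rw [h1.2 hq, h2.2 hq]

end TwoStep

end TypeAnonymous

theorem theorem1 {N : Type*} [Finite N] (A : Set N) (X : Set ℝ) (hX : X.Nonempty)
    (f : TypeAnonymous.Profile A X → X)
    (hΩ : IsClosed {x : ℝ | ∃ R : TypeAnonymous.Profile A X, (f R : ℝ) = x}) :
    List.TFAE [
      TypeAnonymous.IsStrategyProof f ∧ TypeAnonymous.IsTypeAnonymous f,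
      TypeAnonymous.IsGroupStrategyProof f ∧ TypeAnonymous.IsTypeAnonymous f,
      TypeAnonymous.IsTwoStepRule f] := by
  have hclosed : IsClosed (Subtype.val '' Set.range f) := by
    rw [← Set.range_comp]
    exact hΩ
  have hne : (Set.range f).Nonempty := by
    obtain ⟨x, hx⟩ := hX
    exact ⟨_, TypeAnonymous.lowProfile A ⟨x, hx⟩, rfl⟩
  tfae_have 1 → 3 := fun h => h.1.isTwoStepRule h.2 hclosed hne
  tfae_have 3 → 2 := fun h => ⟨h.isGroupStrategyProof hclosed, h.isTypeAnonymous hclosed⟩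
  tfae_have 2 → 1 := by
    refine fun h => ⟨fun R R' i hoff => ?_, h.2⟩
    obtain ⟨j, rfl, hj⟩ := h.1 R R' {i} (Set.singleton_nonempty i) hoff
    exact hj
  tfae_finish
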